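/- **Theorem 2.2 (hydrodynamic limit).** Let $b,c\in C[0,1]$ and $\lambda,a_1,a_2,a_3,a_4\in C([0,1]\times[0,1])$ be non-negative. For each $N\ge 1$ let $\{X_t^N\}_{t\ge 0}$ be the continuous-time Markov process on $[0,\infty)^N$ with generator $$\mathcal L_N g(x)=\sum_{i=1}^N b\left(\tfrac iN\right)\left(g(x^{i,+})-g(x)\right)+\frac1N\sum_{i=1}^N\sum_{j\ne i}\lambda\left(\tfrac iN,\tfrac jN\right)\left(g(x^{(i,j)})-g(x)\right),$$ where $x^{i,+}$ is obtained from $x$ by replacing $x(i)$ by $c(\frac iN)x(i)$, and $x^{(i,j)}$ is obtained from $x$ by replacing $x(i)$ by $a_1(\frac iN,\frac jN)x(i)+a_2(\frac iN,\frac jN)x(j)$ and $x(j)$ by $a_3(\frac iN,\frac jN)x(i)+a_4(\frac iN,\frac jN)x(j)$. Assume (Assumption (A)) that for every $N$ the variables $X_0^N(1),\dots,X_0^N(N)$ are independent with $P(X_0^N(i)=1)=\phi(\frac iN)=1-P(X_0^N(i)=0)$, where $\phi\in C[0,1]$. Put $\mu_t^N(f)=\frac1N\sum_{i=1}^N X_t^N(i)f(\frac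 iN)$ for $f\in C[0,1]$. Let $P_1:C[0,1]\to C[0,1]$ be the bounded linear operator $$\begin{aligned}P_1f(u)={}&b(u)(c(u)-1)f(u)+f(u)\int_0^1\lambda(u,v)(a_1(u,v)-1)\,dv+\int_0^1\lambda(u,v)a_3(u,v)f(v)\,dv\\&+f(u)\int_0^1\lambda(v,u)(a_4(v,u)-1)\,dv+\int_0^1\lambda(v,u)f(v)a_2(v,u)\,dv,\end{aligned}$$ and let $P_1^*$ be its adjoint on the dual space $(C[0,1])'$, $(P_1^*\nu)(f)=\nu(P_1f)$. Then: 1. The $(C[0,1])'$-valued equation $\frac{d}{dt}\mu_t=P_1^*\mu_t$ for $t\ge0$, $\mu_0(du)=\phi(u)\,du$ (derivative in the dual norm) has a unique solution $\{\mu_t\}_{t\ge0}$. 2. The $C[0,1]$-valued equation (derivative in the supremum norm) $$\begin{aligned}\frac{d}{dt}\rho(t,u)={}&b(u)(c(u)-1)\rho(t,u)+\rho(t,u)\int_0^1\lambda(v,u)(a_4(v,u)-1)\,dv+\rho(t,u)\int_0^1\lambda(u,v)(a_1(u,v)-1)\,dv\\&+\int_0^1\lambda(u,v)a_2(u,v)\rho(t,v)\,dv+\int_0^1\lambda(v,u)a_3(v,u)\rho(t,v)\,dv,\qquad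 \rho(0,\cdot)=\phi,\end{aligned}$$ for $t\ge 0$ has a unique solution $\{\rho(t,\cdot)\}_{t\ge0}$. 3. For every $t\ge0$ and $f\in C[0,1]$, the variables $\mu_t^N(f)$ are square integrable and $$\lim_{N\to\infty}\mu_t^N(f)=\mu_t(f)=\int_0^1\rho(t,u)f(u)\,du\quad\text{in }L^2.$$ -/

import Mathlib

open MeasureTheory ProbabilityTheory Filter Topology
open scoped NNReal ENNReal unitInterval BoundedContinuousFunction

noncomputable section

/-- The non-negative continuous coefficient functions of the model:
`b, c` on `[0,1]` and `lam, a₁, a₂, a₃, a₄` on `[0,1] × [0,1]`. -/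
structure UrnCoefficients where
  b : C(I, ℝ≥0)
  c : C(I, ℝ≥0)
  lam : C(I × I, ℝ≥0)
  a₁ : C(I × I, ℝ≥0)
  a₂ : C(I × I, ℝ≥0)
  a₃ : C(I × I, ℝ≥0)
  a₄ : C(I × I, ℝ≥0)

/-- The configuration space `[0,∞)^N` with its product topology and Borel σ-algebra. -/
abbrev Config (N : ℕ) : Type := Fin N → ℝ≥0

/-- The macroscopic position of an urn. The urns `1, …, N` are indexed by `Fin N = {0, …, N - 1}`,
so that urn number `i + 1` has the position `(i + 1) / N`. -/
def site {N : ℕ} (i : Fin N) : I :=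
  ⟨((i : ℕ) + 1 : ℝ) / (N : ℝ), by positivity, by
    have h : ((i : ℕ) + 1 : ℝ) ≤ (N : ℝ) := by exact_mod_cast i.isLt
    exact div_le_one_of_le₀ h (Nat.cast_nonneg N)⟩

/-- The exponential `∑ A ^ n / n!` of a bounded operator on a normed space. -/
def expOp {E : Type*} [NormedAddCommGroup E] [NormedSpace ℝ E] (A : E →L[ℝ] E) : E →L[ℝ] E :=
  NormedSpace.exp A

namespace UrnCoefficients

variable (κ : UrnCoefficients) {N : ℕ}

/-- The transformed configuration `x^{i,+}`. -/
def selfJump (i : Fin N) : C(Config N, Config N) where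
  toFun x k := if k = i then κ.c (site i) * x i else x k
  continuous_toFun := by
    refine continuous_pi fun k => ?_
    split_ifs <;> fun_prop

/-- The transformed configuration `x^{(i,j)}` (used for `i ≠ j`). -/
def pairJump (i j : Fin N) : C(Config N, Config N) where
  toFun x k :=
    if k = i then κ.a₁ (site i, site j) * x i + κ.a₂ (site i, site j) * x j
    else if k = j then κ.a₃ (site i, site j) * x i + κ.a₄ (site i, site j) * x j
    else x k
  continuous_toFun := by
    refine continuous_pi fun k => ?_
    split_ifs <;> fun_prop

/-- The generator of the `N`-urn linear system, as a bounded operator on the Banach space of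
bounded continuous functions on `[0,∞)^N`; see `generator_apply` for its values. -/
def generator (N : ℕ) : (Config N →ᵇ ℝ) →L[ℝ] (Config N →ᵇ ℝ) :=
  (∑ i : Fin N, (κ.b (site i) : ℝ) •
      (BoundedContinuousFunction.compContinuousCLM ℝ ℝ (κ.selfJump i) -
        ContinuousLinearMap.id ℝ (Config N →ᵇ ℝ))) +
    (1 / (N : ℝ)) • ∑ i : Fin N, ∑ j ∈ Finset.univ.erase i, (κ.lam (site i, site j) : ℝ) •
      (BoundedContinuousFunction.compContinuousCLM ℝ ℝ (κ.pairJump i j) -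
        ContinuousLinearMap.id ℝ (Config N →ᵇ ℝ))

theorem generator_apply (N : ℕ) (f : Config N →ᵇ ℝ) (x : Config N) :
    κ.generator N f x =
      (∑ i : Fin N, (κ.b (site i) : ℝ) * (f (κ.selfJump i x) - f x)) +
        (1 / (N : ℝ)) * ∑ i : Fin N, ∑ j ∈ Finset.univ.erase i,
          (κ.lam (site i, site j) : ℝ) * (f (κ.pairJump i j x) - f x) := by
  simp [generator, BoundedContinuousFunction.coe_sum]

/-- The Markov semigroup `S(t) = exp (t L)` with the (bounded) generator `L`. -/
def semigroup (N : ℕ) (t : ℝ≥0) : (Config N →ᵇ ℝ) →L[ℝ] (Config N →ᵇ ℝ) :=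
  expOp ((t : ℝ) • κ.generator N)

/-- `X` is, on the probability space `(Ω, P)`, an `N`-urn linear system: a continuous-time Markov
process on `[0,∞)^N` whose semigroup is generated by `κ.generator N`. The conditional expectation
is taken given the past `σ(X r, r ≤ s)`. -/
structure IsUrnSystem {Ω : Type*} [MeasurableSpace Ω] (N : ℕ) (P : Measure Ω)
    (X : ℝ≥0 → Ω → Config N) : Prop where
  measurable : ∀ t, Measurable (X t)
  markov : ∀ (s t : ℝ≥0) (f : Config N →ᵇ ℝ),
    P[fun ω => f (X (s + t) ω) | ⨆ r ∈ Set.Iic s, MeasurableSpace.comap (X r) inferInstance]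
      =ᵐ[P] fun ω => κ.semigroup N t f (X s ω)

end UrnCoefficients

/-- The initial assumption: the coordinates of the initial configuration are independent and the
one at position `u` is Bernoulli with parameter `φ u`. -/
structure BernoulliInitial {Ω : Type*} [MeasurableSpace Ω] (φ : C(I, ℝ)) {N : ℕ} (P : Measure Ω)
    (X₀ : Ω → Config N) : Prop where
  indep : iIndepFun (fun i ω => X₀ ω i) P
  prob_one : ∀ i, P.real {ω | X₀ ω i = 1} = φ (site i)
  prob_zero : ∀ i, P.real {ω | X₀ ω i = 0} = 1 - φ (site i)

/-- The empirical measure of a configuration, evaluated at a test function. -/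
def empirical {N : ℕ} (x : Config N) (f : C(I, ℝ)) : ℝ :=
  (1 / (N : ℝ)) * ∑ i : Fin N, (x i : ℝ) * f (site i)

/-- The integral operator `f ↦ ∫₀¹ k(·, v) f(v) dv` on `C[0,1]`. -/
def integralOp (k : C(I × I, ℝ)) : C(I, ℝ) →L[ℝ] C(I, ℝ) :=
  LinearMap.mkContinuous
    { toFun := fun f =>
        { toFun := fun u => ∫ v : I, k (u, v) * f v
          continuous_toFun := by
            have h := continuous_parametric_integral_of_continuous (μ := (volume : Measure I))
              (f := fun u v : I => k (u, v) * f v) (by fun_prop) (isCompact_univ (X := I))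
            simpa using h }
      map_add' := fun f g => by
        ext u
        simp only [ContinuousMap.coe_mk, ContinuousMap.add_apply, mul_add]
        refine integral_add ?_ ?_ <;>
          exact (by fun_prop : Continuous _).integrable_of_hasCompactSupport
            (HasCompactSupport.of_compactSpace _)
      map_smul' := fun r f => by
        ext u
        simp only [ContinuousMap.coe_mk, ContinuousMap.smul_apply, smul_eq_mul, RingHom.id_apply,
          ← integral_const_mul]
        refine integral_congr_ae (Eventually.of_forall fun v => ?_)
        simp only []
        ring }
    ‖k‖ (fun f => by
      rw [ContinuousMap.norm_le _ (by positivity)]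
      intro u
      have h := norm_integral_le_of_norm_le_const (μ := (volume : Measure I))
        (f := fun v : I => k (u, v) * f v) (C := ‖k‖ * ‖f‖)
        (Eventually.of_forall fun v => by
          rw [norm_mul]
          exact mul_le_mul (k.norm_coe_le_norm _) (f.norm_coe_le_norm _) (norm_nonneg _)
            (norm_nonneg _))
      simpa using h)

theorem integralOp_apply (k : C(I × I, ℝ)) (f : C(I, ℝ)) (u : I) :
    integralOp k f u = ∫ v : I, k (u, v) * f v := rfl

namespace UrnCoefficients

variable (κ : UrnCoefficients)

/-- The kernel `(u, v) ↦ λ(u,v) (a₁(u,v) - 1) + λ(v,u) (a₄(v,u) - 1)`. -/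
def lossKernel : C(I × I, ℝ) where
  toFun p := (κ.lam p : ℝ) * ((κ.a₁ p : ℝ) - 1) +
    (κ.lam p.swap : ℝ) * ((κ.a₄ p.swap : ℝ) - 1)

/-- The factor in the multiplication part common to both limiting operators:
`b(u) (c(u) - 1) + ∫₀¹ λ(u,v) (a₁(u,v) - 1) dv + ∫₀¹ λ(v,u) (a₄(v,u) - 1) dv`. -/
def rate : C(I, ℝ) :=
  ⟨fun u => (κ.b u : ℝ) * ((κ.c u : ℝ) - 1), by fun_prop⟩ + integralOp κ.lossKernel 1

/-- The operator `P₁` on `C[0,1]`; see `opP₁_apply` for its values. -/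
def opP₁ : C(I, ℝ) →L[ℝ] C(I, ℝ) :=
  ContinuousLinearMap.mul ℝ C(I, ℝ) κ.rate +
    integralOp ⟨fun p => (κ.lam p : ℝ) * (κ.a₃ p : ℝ) +
      (κ.lam p.swap : ℝ) * (κ.a₂ p.swap : ℝ), by fun_prop⟩

/-- The operator on `C[0,1]` on the right-hand side of the equation for the density; see
`densityOp_apply` for its values. -/
def densityOp : C(I, ℝ) →L[ℝ] C(I, ℝ) :=
  ContinuousLinearMap.mul ℝ C(I, ℝ) κ.rate +
    integralOp ⟨fun p => (κ.lam p : ℝ) * (κ.a₂ p : ℝ) +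
      (κ.lam p.swap : ℝ) * (κ.a₃ p.swap : ℝ), by fun_prop⟩

theorem rate_apply (u : I) :
    κ.rate u = (κ.b u : ℝ) * ((κ.c u : ℝ) - 1)
      + (∫ v : I, (κ.lam (u, v) : ℝ) * ((κ.a₁ (u, v) : ℝ) - 1))
      + (∫ v : I, (κ.lam (v, u) : ℝ) * ((κ.a₄ (v, u) : ℝ) - 1)) := by
  rw [add_assoc, ← integral_add]
  · simp [rate, integralOp_apply, lossKernel]
  all_goals
    exact (by fun_prop : Continuous _).integrable_of_hasCompactSupport
      (HasCompactSupport.of_compactSpace _)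

theorem opP₁_apply (f : C(I, ℝ)) (u : I) :
    κ.opP₁ f u = (κ.b u : ℝ) * ((κ.c u : ℝ) - 1) * f u
      + f u * (∫ v : I, (κ.lam (u, v) : ℝ) * ((κ.a₁ (u, v) : ℝ) - 1))
      + (∫ v : I, (κ.lam (u, v) : ℝ) * (κ.a₃ (u, v) : ℝ) * f v)
      + f u * (∫ v : I, (κ.lam (v, u) : ℝ) * ((κ.a₄ (v, u) : ℝ) - 1))
      + (∫ v : I, (κ.lam (v, u) : ℝ) * f v * (κ.a₂ (v, u) : ℝ)) := by
  have h : κ.opP₁ f u = κ.rate u * f u +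
      ((∫ v : I, (κ.lam (u, v) : ℝ) * (κ.a₃ (u, v) : ℝ) * f v)
      + (∫ v : I, (κ.lam (v, u) : ℝ) * f v * (κ.a₂ (v, u) : ℝ))) := by
    rw [← integral_add]
    · simp only [opP₁, add_apply, ContinuousMap.add_apply,
        ContinuousLinearMap.mul_apply', ContinuousMap.mul_apply, integralOp_apply,
        ContinuousMap.coe_mk, Prod.swap_prod_mk]
      congr 1
      refine integral_congr_ae (Eventually.of_forall fun v => ?_)
      simp only []
      ring
    all_goals
      exact (by fun_prop : Continuous _).integrable_of_hasCompactSupport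
        (HasCompactSupport.of_compactSpace _)
  rw [h, rate_apply]
  ring

theorem densityOp_apply (f : C(I, ℝ)) (u : I) :
    κ.densityOp f u = (κ.b u : ℝ) * ((κ.c u : ℝ) - 1) * f u
      + f u * (∫ v : I, (κ.lam (v, u) : ℝ) * ((κ.a₄ (v, u) : ℝ) - 1))
      + f u * (∫ v : I, (κ.lam (u, v) : ℝ) * ((κ.a₁ (u, v) : ℝ) - 1))
      + (∫ v : I, (κ.lam (u, v) : ℝ) * (κ.a₂ (u, v) : ℝ) * f v)
      + (∫ v : I, (κ.lam (v, u) : ℝ) * (κ.a₃ (v, u) : ℝ) * f v) := by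
  have h : κ.densityOp f u = κ.rate u * f u +
      ((∫ v : I, (κ.lam (u, v) : ℝ) * (κ.a₂ (u, v) : ℝ) * f v)
      + (∫ v : I, (κ.lam (v, u) : ℝ) * (κ.a₃ (v, u) : ℝ) * f v)) := by
    rw [← integral_add]
    · simp only [densityOp, add_apply, ContinuousMap.add_apply,
        ContinuousLinearMap.mul_apply', ContinuousMap.mul_apply, integralOp_apply,
        ContinuousMap.coe_mk, Prod.swap_prod_mk]
      congr 1
      refine integral_congr_ae (Eventually.of_forall fun v => ?_)
      simp only []
      ring
    all_goals
      exact (by fun_prop : Continuous _).integrable_of_hasCompactSupport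
        (HasCompactSupport.of_compactSpace _)
  rw [h, rate_apply]
  ring

/-- `μ` solves, on `[0,∞)` and in the dual norm, the equation `dμ_t/dt = P₁^* μ_t` in `(C[0,1])'`
with the initial value `μ_0(du) = φ(u) du`. Here `P₁^* ν = ν ∘ P₁`. The derivative is one-sided
at `t = 0` and two-sided at `t > 0`. -/
structure IsHydrodynamicSolution (φ : C(I, ℝ)) (μ : ℝ → (C(I, ℝ) →L[ℝ] ℝ)) : Prop where
  deriv : ∀ t, 0 ≤ t → HasDerivWithinAt μ ((μ t).comp κ.opP₁) (Set.Ici 0) t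
  init : ∀ f : C(I, ℝ), μ 0 f = ∫ u : I, φ u * f u

/-- `ρ` solves, on `[0,∞)` and in the supremum norm, the `C[0,1]`-valued equation for the density
with the initial value `φ`. -/
structure IsDensitySolution (φ : C(I, ℝ)) (ρ : ℝ → C(I, ℝ)) : Prop where
  deriv : ∀ t, 0 ≤ t → HasDerivWithinAt ρ (κ.densityOp (ρ t)) (Set.Ici 0) t
  init : ρ 0 = φ

end UrnCoefficients

end

/-!
For a fixed test function `g`, the generator applied to `x ↦ μ^N(g)` is `μ^N(P₁ g)` up to the error
of replacing Riemann sums over the sites by integrals. Hence, along `g_s = exp((t - s) P₁) f`, the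
drift of `μ_s^N(g_s)` is only this error, while its carré du champ is `O(1/N)`. So for every
constant `a` the function `s ↦ E (μ_s^N(g_s) - a)²` is nearly constant on `[0, t]`, all error terms
being controlled by the Lyapunov function `1 + N⁻¹ ∑ x(i)²`. At `s = t` it compares `μ_t^N(f)` with
`a`; at `s = 0` the law of large numbers makes it vanish for `a = ∫ φ exp(t P₁) f = μ_t(f)`.
Finally, `P₁` and the operator of the density equation are transposes of each other under the
pairing `∫ ρ f`, so that `ρ(t, u) du` solves the equation for `μ_t`.

The test functions are unbounded, whereas the Markov semigroup acts on bounded functions: they are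
reached by truncation.
-/

noncomputable section

open Asymptotics

/-! ### Forward equations of jump processes -/

theorem abs_sub_sub_mul_le_of_hasDerivWithinAt {S : Set ℝ} (hS : Convex ℝ S) {f f' f'' : ℝ → ℝ}
    {B : ℝ} (hf : ∀ r ∈ S, HasDerivWithinAt f (f' r) S r)
    (hf' : ∀ r ∈ S, HasDerivWithinAt f' (f'' r) S r) (hB : ∀ r ∈ S, |f'' r| ≤ B)
    {r s : ℝ} (hr : r ∈ S) (hs : s ∈ S) : |f r - f s - f' s * (r - s)| ≤ B * (r - s) ^ 2 := by
  have hsub : Set.uIcc s r ⊆ S := by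
    rw [← segment_eq_uIcc]
    exact hS.segment_subset hs hr
  have hderiv : ∀ q ∈ Set.uIcc s r,
      HasDerivWithinAt (fun y => f y - f' s * y) (f' q - f' s * 1) (Set.uIcc s r) q := fun q hq =>
    ((hf q (hsub hq)).mono hsub).sub ((hasDerivWithinAt_id q _).const_mul (f' s))
  have hbound : ∀ q ∈ Set.uIcc s r, ‖f' q - f' s * 1‖ ≤ B * |r - s| := fun q hq => by
    have hlip := hS.norm_image_sub_le_of_norm_hasDerivWithin_le hf' hB hs (hsub hq)
    rw [mul_one]
    exact hlip.trans (mul_le_mul_of_nonneg_left (Set.abs_sub_left_of_mem_uIcc hq)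
      ((abs_nonneg _).trans (hB s hs)))
  have h := (convex_uIcc s r).norm_image_sub_le_of_norm_hasDerivWithin_le hderiv hbound
    Set.left_mem_uIcc Set.right_mem_uIcc
  calc |f r - f s - f' s * (r - s)| = ‖f r - f' s * r - (f s - f' s * s)‖ := by
        rw [Real.norm_eq_abs]
        ring_nf
    _ ≤ B * |r - s| * ‖r - s‖ := h
    _ = B * (r - s) ^ 2 := by rw [Real.norm_eq_abs, mul_assoc, ← sq, sq_abs]

section Truncation

variable {E : Type*} [TopologicalSpace E] {h : E → ℝ}

/-- The truncation of a continuous function at the levels `-n` and `n`. -/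
def truncate (hc : Continuous h) (n : ℕ) : E →ᵇ ℝ :=
  BoundedContinuousFunction.ofNormedAddCommGroup (fun x => max (-n) (min (h x) n))
    (by fun_prop) n fun x => abs_le.2
      ⟨le_max_left _ _, max_le (by linarith [n.cast_nonneg (α := ℝ)]) (min_le_right _ _)⟩

theorem truncate_apply (hc : Continuous h) (n : ℕ) (x : E) :
    truncate hc n x = max (-n : ℝ) (min (h x) n) := rfl

theorem truncate_apply_of_nonneg (hc : Continuous h) (n : ℕ) {x : E} (hx : 0 ≤ h x) :
    truncate hc n x = min (h x) n :=
  max_eq_right (le_trans (by simp) (le_min hx n.cast_nonneg))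

theorem abs_truncate_le (hc : Continuous h) (n : ℕ) (x : E) : |truncate hc n x| ≤ |h x| := by
  have hn : (0 : ℝ) ≤ n := n.cast_nonneg
  rw [truncate_apply]
  grind

theorem tendsto_truncate (hc : Continuous h) (x : E) :
    Tendsto (fun n => truncate hc n x) atTop (𝓝 (h x)) := by
  obtain ⟨m, hm⟩ := exists_nat_ge |h x|
  refine tendsto_const_nhds.congr' ?_
  filter_upwards [eventually_ge_atTop m] with n hn
  obtain ⟨hlow, hupp⟩ := abs_le.1 (hm.trans (Nat.cast_le.2 hn))
  rw [truncate_apply, min_eq_left hupp, max_eq_right hlow]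

end Truncation

section JumpGenerator

variable {E J : Type*} [TopologicalSpace E] [Fintype J]

/-- The generator `h ↦ ∑ₑ wₑ (h ∘ Tₑ - h)` of the jump process which applies the map `Tₑ` at the
rate `wₑ`, on arbitrary real functions. -/
def jumpGen (w : J → ℝ) (T : J → C(E, E)) (h : E → ℝ) (x : E) : ℝ :=
  ∑ e, w e * (h (T e x) - h x)

variable {w : J → ℝ} {T : J → C(E, E)}

theorem continuous_jumpGen {h : E → ℝ} (hc : Continuous h) : Continuous (jumpGen w T h) := by
  unfold jumpGen
  fun_prop

theorem exists_coe_eq_jumpGen (w : J → ℝ) (T : J → C(E, E)) (f : E →ᵇ ℝ) :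
    ∃ g : E →ᵇ ℝ, ⇑g = jumpGen w T f :=
  ⟨∑ e, w e • (f.compContinuous (T e) - f), by
    ext x
    simp [jumpGen, BoundedContinuousFunction.coe_sum]⟩

theorem jumpGen_sq (h : E → ℝ) (x : E) :
    jumpGen w T (fun y => h y ^ 2) x =
      2 * h x * jumpGen w T h x + ∑ e, w e * (h (T e x) - h x) ^ 2 := by
  simp only [jumpGen, Finset.mul_sum, ← Finset.sum_add_distrib]
  exact Finset.sum_congr rfl fun e _ => by ring

theorem jumpGen_sum {ι : Type*} (s : Finset ι) (c : ι → ℝ) (h : ι → E → ℝ) (x : E) :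
    jumpGen w T (fun y => ∑ k ∈ s, c k * h k y) x = ∑ k ∈ s, c k * jumpGen w T (h k) x := by
  simp only [jumpGen, Finset.mul_sum, ← Finset.sum_sub_distrib]
  rw [Finset.sum_comm]
  exact Finset.sum_congr rfl fun k _ => Finset.sum_congr rfl fun e _ => by ring

/-- The majorant `∑ₑ |wₑ| (g ∘ Tₑ + g)` of `jumpGen w T h` for functions with `|h| ≤ g`. -/
def jumpBound (w : J → ℝ) (T : J → C(E, E)) (g : E → ℝ) (x : E) : ℝ :=
  ∑ e, |w e| * (g (T e x) + g x)

theorem continuous_jumpBound {g : E → ℝ} (hc : Continuous g) : Continuous (jumpBound w T g) := by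
  unfold jumpBound
  fun_prop

theorem abs_jumpGen_le {h g : E → ℝ} (hhg : ∀ x, |h x| ≤ g x) (x : E) :
    |jumpGen w T h x| ≤ jumpBound w T g x := by
  refine (Finset.abs_sum_le_sum_abs _ _).trans (Finset.sum_le_sum fun e _ => ?_)
  rw [abs_mul]
  gcongr
  exact (abs_sub _ _).trans (add_le_add (hhg _) (hhg _))

/-- `V` is a continuous Lyapunov function with the growth rate `C` for the jump process with the
rates `w` and the maps `T`, and a jump multiplies it at most by a constant. -/
structure IsLyapunov (w : J → ℝ) (T : J → C(E, E)) (V : E → ℝ) (C : ℝ) : Prop where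
  continuous : Continuous V
  nonneg : ∀ x, 0 ≤ V x
  rate_nonneg : ∀ e, 0 ≤ w e
  growth_nonneg : 0 ≤ C
  jumpGen_le : ∀ x, jumpGen w T V x ≤ C * V x
  comp_isBigO : ∀ e, (fun x => V (T e x)) =O[⊤] V

namespace IsLyapunov

variable {V : E → ℝ} {C : ℝ}

theorem comp_isBigO_of_isBigO (hV : IsLyapunov w T V C) {h : E → ℝ} (hO : h =O[⊤] V) (e : J) :
    (fun x => h (T e x)) =O[⊤] V :=
  (hO.comp_tendsto tendsto_top).trans (hV.comp_isBigO e)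

theorem jumpGen_isBigO (hV : IsLyapunov w T V C) {h : E → ℝ} (hO : h =O[⊤] V) :
    jumpGen w T h =O[⊤] V :=
  IsBigO.fun_sum fun e _ => ((hV.comp_isBigO_of_isBigO hO e).sub hO).const_mul_left _

theorem jumpBound_isBigO (hV : IsLyapunov w T V C) {g : E → ℝ} (hO : g =O[⊤] V) :
    jumpBound w T g =O[⊤] V :=
  IsBigO.fun_sum fun e _ => ((hV.comp_isBigO_of_isBigO hO e).add hO).const_mul_left _

theorem jumpGen_truncate_le (hV : IsLyapunov w T V C) (n : ℕ) (x : E) :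
    jumpGen w T (truncate hV.continuous n) x ≤ C * truncate hV.continuous n x := by
  simp only [jumpGen, truncate_apply_of_nonneg _ _ (hV.nonneg _)]
  rcases le_total (V x) n with hx | hx
  · rw [min_eq_left hx]
    refine le_trans (Finset.sum_le_sum fun e _ => ?_) (hV.jumpGen_le x)
    exact mul_le_mul_of_nonneg_left (sub_le_sub_right (min_le_left _ _) _) (hV.rate_nonneg e)
  · rw [min_eq_right hx]
    refine (Finset.sum_nonpos fun e _ => ?_).trans (mul_nonneg hV.growth_nonneg n.cast_nonneg)
    exact mul_nonpos_of_nonneg_of_nonpos (hV.rate_nonneg e) (sub_nonpos.2 (min_le_right _ _))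

end IsLyapunov

variable [MeasurableSpace E] [OpensMeasurableSpace E]

/-- A family of finite measures which solves the forward equation of the jump generator, tested
against the bounded continuous functions. -/
structure IsForwardSolution (w : J → ℝ) (T : J → C(E, E)) (ν : ℝ → Measure E) : Prop where
  isFiniteMeasure : ∀ s, IsFiniteMeasure (ν s)
  hasDeriv : ∀ (f : E →ᵇ ℝ) (s : ℝ), 0 ≤ s →
    HasDerivWithinAt (fun r => ∫ x, f x ∂ν r) (∫ x, jumpGen w T f x ∂ν s) (Set.Ici 0) s

namespace IsForwardSolution

variable {ν : ℝ → Measure E} {V : E → ℝ} {C : ℝ}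

theorem integrable_boundedContinuous (hν : IsForwardSolution w T ν) (f : E →ᵇ ℝ) (s : ℝ) :
    Integrable f (ν s) :=
  have := hν.isFiniteMeasure s
  f.integrable _

theorem integrable_jumpGen_boundedContinuous (hν : IsForwardSolution w T ν) (f : E →ᵇ ℝ) (s : ℝ) :
    Integrable (jumpGen w T f) (ν s) := by
  obtain ⟨g, hg⟩ := exists_coe_eq_jumpGen w T f
  exact hg ▸ hν.integrable_boundedContinuous g s

theorem integral_truncate_le (hν : IsForwardSolution w T ν) (hV : IsLyapunov w T V C)
    (h₀ : Integrable V (ν 0)) {s : ℝ} (hs : 0 ≤ s) (n : ℕ) :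
    ∫ x, truncate hV.continuous n x ∂ν s ≤ Real.exp (C * s) * ∫ x, V x ∂ν 0 := by
  set F := truncate hV.continuous n
  have hF : ∀ r, 0 ≤ r → ∫ x, jumpGen w T F x ∂ν r ≤ C * ∫ x, F x ∂ν r := fun r _ => by
    rw [← integral_const_mul]
    exact integral_mono (hν.integrable_jumpGen_boundedContinuous F r)
      ((hν.integrable_boundedContinuous F r).const_mul C) (hV.jumpGen_truncate_le n)
  have hinit : ∫ x, F x ∂ν 0 ≤ ∫ x, V x ∂ν 0 :=
    integral_mono (hν.integrable_boundedContinuous F 0) h₀ fun x =>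
      (le_abs_self _).trans ((abs_truncate_le _ n x).trans_eq (abs_of_nonneg (hV.nonneg x)))
  have hgronwall := le_gronwallBound_of_liminf_deriv_right_le (f := fun r => ∫ x, F x ∂ν r)
    (f' := fun r => ∫ x, jumpGen w T F x ∂ν r) (ε := 0)
    (fun r hr => (hν.hasDeriv F r hr.1).continuousWithinAt.mono Set.Icc_subset_Ici_self)
    (fun r hr q hq => ((hν.hasDeriv F r hr.1).mono
      (Set.Ici_subset_Ici.2 hr.1)).liminf_right_slope_le hq)
    hinit (fun r hr => (hF r hr.1).trans_eq (add_zero _).symm) s ⟨hs, le_rfl⟩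
  rwa [gronwallBound_ε0, sub_zero, mul_comm] at hgronwall

theorem lintegral_lyapunov_le (hν : IsForwardSolution w T ν) (hV : IsLyapunov w T V C)
    (h₀ : Integrable V (ν 0)) {s : ℝ} (hs : 0 ≤ s) :
    ∫⁻ x, ENNReal.ofReal (V x) ∂ν s ≤ ENNReal.ofReal (Real.exp (C * s) * ∫ x, V x ∂ν 0) := by
  have hnonneg : ∀ n x, 0 ≤ truncate hV.continuous n x := fun n x => by
    rw [truncate_apply_of_nonneg _ _ (hV.nonneg x)]
    exact le_min (hV.nonneg x) n.cast_nonneg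
  have hmono : ∀ x, Monotone fun n => ENNReal.ofReal (truncate hV.continuous n x) :=
    fun x m n hmn => ENNReal.ofReal_le_ofReal <| by
      simp only [truncate_apply_of_nonneg _ _ (hV.nonneg x)]
      gcongr
  refine le_of_tendsto' (lintegral_tendsto_of_tendsto_of_monotone
    (fun n => (truncate hV.continuous n).continuous.measurable.ennreal_ofReal.aemeasurable)
    (ae_of_all _ hmono)
    (ae_of_all _ fun x => (ENNReal.continuous_ofReal.tendsto _).comp
      (tendsto_truncate hV.continuous x))) fun n => ?_
  rw [← ofReal_integral_eq_lintegral_ofReal (hν.integrable_boundedContinuous _ s)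
    (ae_of_all _ (hnonneg n))]
  exact ENNReal.ofReal_le_ofReal (hν.integral_truncate_le hV h₀ hs n)

theorem integrable_lyapunov (hν : IsForwardSolution w T ν) (hV : IsLyapunov w T V C)
    (h₀ : Integrable V (ν 0)) {s : ℝ} (hs : 0 ≤ s) : Integrable V (ν s) := by
  refine ⟨hV.continuous.measurable.aestronglyMeasurable, ?_⟩
  rw [hasFiniteIntegral_iff_ofReal (ae_of_all _ hV.nonneg)]
  exact (hν.lintegral_lyapunov_le hV h₀ hs).trans_lt ENNReal.ofReal_lt_top

theorem integral_lyapunov_le (hν : IsForwardSolution w T ν) (hV : IsLyapunov w T V C)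
    (h₀ : Integrable V (ν 0)) {s t : ℝ} (hs : 0 ≤ s) (hst : s ≤ t) :
    ∫ x, V x ∂ν s ≤ Real.exp (C * t) * ∫ x, V x ∂ν 0 := by
  have hV₀ : 0 ≤ ∫ x, V x ∂ν 0 := integral_nonneg hV.nonneg
  have h := hν.lintegral_lyapunov_le hV h₀ hs
  rw [← ofReal_integral_eq_lintegral_ofReal (hν.integrable_lyapunov hV h₀ hs)
    (ae_of_all _ hV.nonneg), ENNReal.ofReal_le_ofReal_iff (by positivity)] at h
  refine h.trans ?_
  have := hV.growth_nonneg
  gcongr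

theorem integrable_of_isBigO (hν : IsForwardSolution w T ν) (hV : IsLyapunov w T V C)
    (h₀ : Integrable V (ν 0)) {h : E → ℝ} (hc : Continuous h) (hO : h =O[⊤] V) {s : ℝ}
    (hs : 0 ≤ s) : Integrable h (ν s) :=
  hO.integrable hc.measurable.aestronglyMeasurable (hν.integrable_lyapunov hV h₀ hs)

theorem exists_abs_integral_le (hν : IsForwardSolution w T ν) (hV : IsLyapunov w T V C)
    (h₀ : Integrable V (ν 0)) {g : E → ℝ} (hO : g =O[⊤] V) (t : ℝ) :
    ∃ B, ∀ s ∈ Set.Icc 0 t, ∀ h : E → ℝ, (∀ x, |h x| ≤ g x) → |∫ x, h x ∂ν s| ≤ B := by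
  obtain ⟨A, hA, hgA⟩ := hO.exists_nonneg
  refine ⟨A * (Real.exp (C * t) * ∫ x, V x ∂ν 0), fun s hs h hh => ?_⟩
  have hgV : ∀ x, g x ≤ A * V x := fun x => (le_abs_self _).trans <| by
    simpa [abs_of_nonneg (hV.nonneg x)] using isBigOWith_top.1 hgA x
  calc |∫ x, h x ∂ν s| ≤ ∫ x, A * V x ∂ν s :=
        norm_integral_le_of_norm_le (f := h) ((hν.integrable_lyapunov hV h₀ hs.1).const_mul A)
          (ae_of_all _ fun x => (hh x).trans (hgV x))
    _ = A * ∫ x, V x ∂ν s := integral_const_mul _ _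
    _ ≤ A * (Real.exp (C * t) * ∫ x, V x ∂ν 0) := by
        gcongr
        exact hν.integral_lyapunov_le hV h₀ hs.1 hs.2

theorem tendsto_integral_truncate (hν : IsForwardSolution w T ν) (hV : IsLyapunov w T V C)
    (h₀ : Integrable V (ν 0)) {h : E → ℝ} (hc : Continuous h) (hO : h =O[⊤] V) {s : ℝ}
    (hs : 0 ≤ s) :
    Tendsto (fun n => ∫ x, truncate hc n x ∂ν s) atTop (𝓝 (∫ x, h x ∂ν s)) :=
  tendsto_integral_of_dominated_convergence (fun x => |h x|)
    (fun _ => (hν.integrable_boundedContinuous _ s).aestronglyMeasurable)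
    (hν.integrable_of_isBigO hV h₀ hc hO hs).abs
    (fun n => ae_of_all _ (abs_truncate_le hc n)) (ae_of_all _ (tendsto_truncate hc))

theorem tendsto_integral_jumpGen_truncate (hν : IsForwardSolution w T ν)
    (hV : IsLyapunov w T V C) (h₀ : Integrable V (ν 0)) {h : E → ℝ} (hc : Continuous h)
    (hO : h =O[⊤] V) {s : ℝ} (hs : 0 ≤ s) :
    Tendsto (fun n => ∫ x, jumpGen w T (truncate hc n) x ∂ν s) atTop
      (𝓝 (∫ x, jumpGen w T h x ∂ν s)) :=
  tendsto_integral_of_dominated_convergence (jumpBound w T fun x => |h x|)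
    (fun _ => (hν.integrable_jumpGen_boundedContinuous _ s).aestronglyMeasurable)
    (hν.integrable_of_isBigO hV h₀ (continuous_jumpBound hc.abs)
      (hV.jumpBound_isBigO hO.abs_left) hs)
    (fun n => ae_of_all _ (abs_jumpGen_le (abs_truncate_le hc n)))
    (ae_of_all _ fun x => tendsto_finsetSum _ fun e _ =>
      ((tendsto_truncate hc (T e x)).sub (tendsto_truncate hc x)).const_mul (w e))

theorem exists_abs_integral_sub_sub_mul_le (hν : IsForwardSolution w T ν)
    (hV : IsLyapunov w T V C) (h₀ : Integrable V (ν 0)) {h : E → ℝ} (hc : Continuous h)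
    (hO : h =O[⊤] V) (t : ℝ) :
    ∃ B, ∀ r ∈ Set.Icc 0 t, ∀ s ∈ Set.Icc 0 t,
      |∫ x, h x ∂ν r - ∫ x, h x ∂ν s - (∫ x, jumpGen w T h x ∂ν s) * (r - s)| ≤
        B * (r - s) ^ 2 := by
  -- The second time derivative of the pairing with a truncation is bounded uniformly in the level.
  obtain ⟨B, hB⟩ := hν.exists_abs_integral_le hV h₀
    (hV.jumpBound_isBigO (hV.jumpBound_isBigO hO.abs_left)) t
  have hsub : Set.Icc 0 t ⊆ Set.Ici (0 : ℝ) := Set.Icc_subset_Ici_self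
  refine ⟨B, fun r hr s hs => le_of_tendsto'
    (((hν.tendsto_integral_truncate hV h₀ hc hO hr.1).sub
      (hν.tendsto_integral_truncate hV h₀ hc hO hs.1)).sub
      ((hν.tendsto_integral_jumpGen_truncate hV h₀ hc hO hs.1).mul_const (r - s))).abs
    fun n => ?_⟩
  obtain ⟨g, hg⟩ := exists_coe_eq_jumpGen w T (truncate hc n)
  rw [← hg]
  refine abs_sub_sub_mul_le_of_hasDerivWithinAt (convex_Icc 0 t)
    (f := fun q => ∫ x, truncate hc n x ∂ν q) (f' := fun q => ∫ x, g x ∂ν q)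
    (f'' := fun q => ∫ x, jumpGen w T g x ∂ν q)
    (fun q hq => hg ▸ (hν.hasDeriv _ q hq.1).mono hsub)
    (fun q hq => (hν.hasDeriv g q hq.1).mono hsub)
    (fun q hq => hB q hq _ (abs_jumpGen_le fun x => ?_)) hr hs
  rw [hg]
  exact abs_jumpGen_le (abs_truncate_le hc n) x

theorem hasDerivWithinAt_integral (hν : IsForwardSolution w T ν) (hV : IsLyapunov w T V C)
    (h₀ : Integrable V (ν 0)) {h : E → ℝ} (hc : Continuous h) (hO : h =O[⊤] V) {s : ℝ}
    (hs : 0 ≤ s) :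
    HasDerivWithinAt (fun r => ∫ x, h x ∂ν r) (∫ x, jumpGen w T h x ∂ν s) (Set.Ici 0) s := by
  obtain ⟨B, hB⟩ := hν.exists_abs_integral_sub_sub_mul_le hV h₀ hc hO (s + 1)
  rw [hasDerivWithinAt_iff_isLittleO]
  refine (IsBigO.of_bound B ?_).trans_isLittleO
    ((isLittleO_pow_sub_sub s one_lt_two).mono nhdsWithin_le_nhds)
  filter_upwards [self_mem_nhdsWithin,
    nhdsWithin_le_nhds (Iic_mem_nhds (lt_add_one s))] with r hr hr'
  simpa [mul_comm] using hB r ⟨hr, hr'⟩ s ⟨hs, by linarith⟩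

theorem hasDerivWithinAt_integral_sum (hν : IsForwardSolution w T ν) (hV : IsLyapunov w T V C)
    (h₀ : Integrable V (ν 0)) {ι : Type*} [Fintype ι] {h : ι → E → ℝ}
    (hc : ∀ k, Continuous (h k)) (hO : ∀ k, h k =O[⊤] V) {c : ι → ℝ → ℝ} {c' : ι → ℝ} {s : ℝ}
    (hs : 0 ≤ s) (hcd : ∀ k, HasDerivWithinAt (c k) (c' k) (Set.Ici 0) s) :
    HasDerivWithinAt (fun r => ∫ x, ∑ k, c k r * h k x ∂ν r)
      (∫ x, (∑ k, c' k * h k x + jumpGen w T (fun y => ∑ k, c k s * h k y) x) ∂ν s)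
      (Set.Ici 0) s := by
  have hint : ∀ k r, 0 ≤ r → Integrable (h k) (ν r) := fun k _ hr =>
    hν.integrable_of_isBigO hV h₀ (hc k) (hO k) hr
  have hintL : ∀ k, Integrable (jumpGen w T (h k)) (ν s) := fun k =>
    hν.integrable_of_isBigO hV h₀ (continuous_jumpGen (hc k)) (hV.jumpGen_isBigO (hO k)) hs
  have hsum : ∀ r ∈ Set.Ici (0 : ℝ),
      ∫ x, ∑ k, c k r * h k x ∂ν r = ∑ k, c k r * ∫ x, h k x ∂ν r := fun r hr => by
    rw [integral_finsetSum _ fun k _ => (hint k r hr).const_mul _]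
    simp only [integral_const_mul]
  have hderiv : ∫ x, (∑ k, c' k * h k x + jumpGen w T (fun y => ∑ k, c k s * h k y) x) ∂ν s =
      ∑ k, (c' k * ∫ x, h k x ∂ν s + c k s * ∫ x, jumpGen w T (h k) x ∂ν s) := by
    simp only [jumpGen_sum, ← Finset.sum_add_distrib]
    rw [integral_finsetSum _ fun k _ =>
      ((hint k s hs).const_mul (c' k)).fun_add ((hintL k).const_mul (c k s))]
    refine Finset.sum_congr rfl fun k _ => ?_
    rw [integral_add ((hint k s hs).const_mul _) ((hintL k).const_mul _), integral_const_mul,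
      integral_const_mul]
  rw [hderiv]
  exact (HasDerivWithinAt.fun_sum fun k _ => (hcd k).mul
    (hν.hasDerivWithinAt_integral hV h₀ (hc k) (hO k) hs)).congr hsum (hsum s hs)

theorem hasDerivWithinAt_integral_sum_sq (hν : IsForwardSolution w T ν)
    (hV : IsLyapunov w T V C) (h₀ : Integrable V (ν 0)) {ι : Type*} [Fintype ι] {h : ι → E → ℝ}
    (hc : ∀ k, Continuous (h k)) (hO : ∀ k l, (fun x => h k x * h l x) =O[⊤] V)
    {c : ι → ℝ → ℝ} {c' : ι → ℝ} {s : ℝ} (hs : 0 ≤ s)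
    (hcd : ∀ k, HasDerivWithinAt (c k) (c' k) (Set.Ici 0) s) :
    HasDerivWithinAt (fun r => ∫ x, (∑ k, c k r * h k x) ^ 2 ∂ν r)
      (∫ x, (2 * (∑ k, c k s * h k x) * (∑ k, c' k * h k x) +
        jumpGen w T (fun y => (∑ k, c k s * h k y) ^ 2) x) ∂ν s) (Set.Ici 0) s := by
  have hsq : ∀ r x, (∑ k, c k r * h k x) ^ 2 =
      ∑ p : ι × ι, (c p.1 r * c p.2 r) * (h p.1 x * h p.2 x) := fun r x => by
    rw [sq, Finset.sum_mul_sum, Fintype.sum_prod_type]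
    exact Finset.sum_congr rfl fun k _ => Finset.sum_congr rfl fun l _ => by ring
  have hprod : ∀ x, 2 * (∑ k, c k s * h k x) * (∑ k, c' k * h k x) =
      ∑ p : ι × ι, (c' p.1 * c p.2 s + c p.1 s * c' p.2) * (h p.1 x * h p.2 x) := fun x => by
    rw [mul_assoc, two_mul]
    nth_rewrite 1 [mul_comm]
    simp only [Finset.sum_mul_sum, Fintype.sum_prod_type, ← Finset.sum_add_distrib]
    exact Finset.sum_congr rfl fun k _ => Finset.sum_congr rfl fun l _ => by ring
  simp only [hsq, hprod]
  exact hν.hasDerivWithinAt_integral_sum hV h₀ (fun p : ι × ι => (hc p.1).mul (hc p.2))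
    (fun p => hO p.1 p.2) hs fun p => (hcd p.1).mul (hcd p.2)

theorem integral_sum_sq_le (hν : IsForwardSolution w T ν) (hV : IsLyapunov w T V C)
    (h₀ : Integrable V (ν 0)) {ι : Type*} [Fintype ι] {h : ι → E → ℝ}
    (hc : ∀ k, Continuous (h k)) (hO : ∀ k l, (fun x => h k x * h l x) =O[⊤] V)
    {c c' : ι → ℝ → ℝ} {t δ : ℝ} (ht : 0 ≤ t) (hδ : 0 ≤ δ)
    (hcd : ∀ k, ∀ s ∈ Set.Icc 0 t, HasDerivWithinAt (c k) (c' k s) (Set.Ici 0) s)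
    (hdrift : ∀ s ∈ Set.Icc 0 t, ∀ x,
      2 * (∑ k, c k s * h k x) * (∑ k, c' k s * h k x) +
        jumpGen w T (fun y => (∑ k, c k s * h k y) ^ 2) x ≤ δ * V x) :
    ∫ x, (∑ k, c k t * h k x) ^ 2 ∂ν t ≤
      ∫ x, (∑ k, c k 0 * h k x) ^ 2 ∂ν 0 + δ * (Real.exp (C * t) * ∫ x, V x ∂ν 0) * t := by
  set D := δ * (Real.exp (C * t) * ∫ x, V x ∂ν 0)
  have hderiv := fun s (hs : s ∈ Set.Icc 0 t) =>
    hν.hasDerivWithinAt_integral_sum_sq hV h₀ hc hO hs.1 fun k => hcd k s hs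
  have hprod : ∀ a b : ι → ℝ, (fun x => (∑ k, a k * h k x) * (∑ k, b k * h k x)) =O[⊤] V := by
    intro a b
    simp only [Finset.sum_mul_sum]
    exact IsBigO.fun_sum fun k _ => IsBigO.fun_sum fun l _ =>
      ((hO k l).const_mul_left (a k * b l)).congr_left fun x => by ring
  have hslope : ∀ s ∈ Set.Icc 0 t, (∫ x, (2 * (∑ k, c k s * h k x) * (∑ k, c' k s * h k x) +
      jumpGen w T (fun y => (∑ k, c k s * h k y) ^ 2) x) ∂ν s) ≤ D := fun s hs => by
    refine (integral_mono (g := fun x => δ * V x) (hν.integrable_of_isBigO hV h₀ ?_ ?_ hs.1)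
      ((hν.integrable_lyapunov hV h₀ hs.1).const_mul δ) (hdrift s hs)).trans ?_
    · have hL := continuous_jumpGen (w := w) (T := T)
        (by fun_prop : Continuous fun y => (∑ k, c k s * h k y) ^ 2)
      fun_prop
    · simp only [sq, mul_assoc]
      exact ((hprod _ _).const_mul_left 2).add (hV.jumpGen_isBigO (hprod _ _))
    · rw [integral_const_mul]
      exact mul_le_mul_of_nonneg_left (hν.integral_lyapunov_le hV h₀ hs.1 hs.2) hδ
  exact image_le_of_deriv_right_le_deriv_boundary
    (B := fun s => ∫ x, (∑ k, c k 0 * h k x) ^ 2 ∂ν 0 + D * s) (B' := fun _ => D)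
    (fun s hs => (hderiv s hs).continuousWithinAt.mono Set.Icc_subset_Ici_self)
    (fun s hs => (hderiv s (Set.Ico_subset_Icc_self hs)).mono (Set.Ici_subset_Ici.2 hs.1))
    (by simp) (by fun_prop)
    (fun s _ => by
      simpa using ((hasDerivWithinAt_id s (Set.Ici s)).const_mul D).const_add
        (∫ x, (∑ k, c k 0 * h k x) ^ 2 ∂ν 0))
    (fun s hs => hslope s (Set.Ico_subset_Icc_self hs)) ⟨ht, le_rfl⟩

end IsForwardSolution

end JumpGenerator

/-! ### The limit equations -/

section SiteAverage

/-- The average of a vector valued function over the positions of the `N` urns. -/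
def siteAverage {F : Type*} [AddCommGroup F] [Module ℝ F] (N : ℕ) (g : I → F) : F :=
  (1 / (N : ℝ)) • ∑ j : Fin N, g (site j)

variable {F : Type*} [NormedAddCommGroup F] [NormedSpace ℝ F]

theorem integral_unitInterval_eq (g : I → F) :
    ∫ v : I, g v = ∫ x in (0 : ℝ)..1, g (Set.projIcc 0 1 zero_le_one x) := by
  rw [intervalIntegral.integral_of_le zero_le_one, ← integral_Icc_eq_integral_Ioc,
    ← integral_subtype measurableSet_Icc]
  simp only [Set.projIcc_val]

variable [CompleteSpace F]

theorem norm_smul_sub_intervalIntegral_le {a b ε : ℝ} (hab : a ≤ b) {G : ℝ → F} {y : F}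
    (hG : IntervalIntegrable G volume a b) (hy : ∀ x ∈ Set.Ioc a b, ‖y - G x‖ ≤ ε) :
    ‖(b - a) • y - ∫ x in a..b, G x‖ ≤ ε * (b - a) := by
  rw [← intervalIntegral.integral_const, ← intervalIntegral.integral_sub
    intervalIntegrable_const hG, ← abs_of_nonneg (sub_nonneg.2 hab)]
  exact intervalIntegral.norm_integral_le_of_norm_le_const (Set.uIoc_of_le hab ▸ hy)

theorem norm_siteAverage_sub_integral_le {N : ℕ} (hN : N ≠ 0) (g : C(I, F))
    {ε : ℝ} (hg : ∀ u v : I, |(u : ℝ) - v| ≤ 1 / N → ‖g u - g v‖ ≤ ε) :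
    ‖siteAverage N g - ∫ v : I, g v‖ ≤ ε := by
  set G : ℝ → F := fun x => g (Set.projIcc 0 1 zero_le_one x)
  have hGc : Continuous G := g.continuous.comp continuous_projIcc
  have hcells : ∫ v : I, g v =
      ∑ j : Fin N, ∫ x in ((j : ℕ) / N : ℝ)..(((j : ℕ) + 1 : ℕ) / N : ℝ), G x := by
    rw [← Finset.sum_range fun k : ℕ => ∫ x in (k / N : ℝ)..((k + 1 : ℕ) / N : ℝ), G x,
      intervalIntegral.sum_integral_adjacent_intervals (a := fun k : ℕ => (k / N : ℝ))
      fun k _ => hGc.intervalIntegrable _ _, integral_unitInterval_eq]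
    simp [hN, G]
  have hcell : ∀ j : Fin N, ‖(1 / (N : ℝ)) • g (site j) -
      ∫ x in ((j : ℕ) / N : ℝ)..(((j : ℕ) + 1 : ℕ) / N : ℝ), G x‖ ≤ ε * (1 / N) := fun j => by
    have hlen : (((j : ℕ) + 1 : ℕ) / N : ℝ) - ((j : ℕ) / N : ℝ) = 1 / N := by
      push_cast
      ring
    rw [← hlen]
    refine norm_smul_sub_intervalIntegral_le (by gcongr; simp) (hGc.intervalIntegrable _ _)
      fun x hx => hg _ _ ?_
    have hx1 : (((j : ℕ) + 1 : ℕ) / N : ℝ) ≤ 1 :=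
      div_le_one_of_le₀ (by exact_mod_cast j.isLt) N.cast_nonneg
    rw [Set.projIcc_of_mem zero_le_one ⟨le_trans (by positivity) hx.1.le, hx.2.trans hx1⟩, abs_le]
    simp only [site] at hlen ⊢
    push_cast at hlen hx ⊢
    constructor <;> linarith [hx.1, hx.2, hlen]
  rw [siteAverage, hcells, Finset.smul_sum, ← Finset.sum_sub_distrib]
  refine (norm_sum_le_of_le _ fun j _ => hcell j).trans_eq ?_
  rw [Finset.sum_const, Finset.card_univ, Fintype.card_fin, nsmul_eq_mul]
  field_simp

theorem tendsto_siteAverage (g : C(I, F)) :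
    Tendsto (fun N => siteAverage N g) atTop (𝓝 (∫ v : I, g v)) := by
  refine Metric.tendsto_nhds.2 fun ε hε => ?_
  obtain ⟨δ, hδ, hosc⟩ := Metric.uniformContinuous_iff.1
    (CompactSpace.uniformContinuous_of_continuous g.continuous) (ε / 2) (half_pos hε)
  filter_upwards [(tendsto_one_div_atTop_nhds_zero_nat (𝕜 := ℝ)).eventually (gt_mem_nhds hδ),
    eventually_ne_atTop 0] with N hNδ hN
  rw [dist_eq_norm]
  refine (norm_siteAverage_sub_integral_le hN g fun u v huv => ?_).trans_lt (half_lt_self hε)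
  exact (dist_eq_norm (g u) _).symm.trans_le (hosc (huv.trans_lt hNδ)).le

theorem abs_siteAverage_sub_integral_le {Y : Type*} [TopologicalSpace Y] [CompactSpace Y]
    (G : C(I, C(Y, ℝ))) (y : Y) (N : ℕ) :
    |siteAverage N (fun v => G v y) - ∫ v : I, G v y| ≤ ‖siteAverage N G - ∫ v : I, G v‖ := by
  have heval : siteAverage N (fun v => G v y) - ∫ v : I, G v y =
      (siteAverage N G - ∫ v : I, G v) y := by
    have hint : Integrable G :=
      G.continuous.integrable_of_hasCompactSupport (HasCompactSupport.of_compactSpace _)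
    have h := (ContinuousMap.evalCLM ℝ y).integral_comp_comm hint
    simp only [ContinuousMap.evalCLM_apply] at h
    simp [siteAverage, h]
  rw [heval]
  exact (siteAverage N G - ∫ v : I, G v).norm_coe_le_norm y

end SiteAverage

section LinearODE

variable {F : Type*} [NormedAddCommGroup F] [NormedSpace ℝ F]

theorem eqOn_of_hasDerivWithinAt_clm (A : F →L[ℝ] F) {y z : ℝ → F}
    (hy : ∀ t, 0 ≤ t → HasDerivWithinAt y (A (y t)) (Set.Ici 0) t)
    (hz : ∀ t, 0 ≤ t → HasDerivWithinAt z (A (z t)) (Set.Ici 0) t) (h₀ : y 0 = z 0) :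
    Set.EqOn y z (Set.Ici 0) := by
  intro t ht
  have hcont : ∀ {x : ℝ → F}, (∀ t, 0 ≤ t → HasDerivWithinAt x (A (x t)) (Set.Ici 0) t) →
      ContinuousOn x (Set.Icc 0 t) := fun hx r hr =>
    (hx r hr.1).continuousWithinAt.mono Set.Icc_subset_Ici_self
  exact ODE_solution_unique (v := fun _ => A) (fun _ => A.lipschitz) (hcont hy)
    (fun r hr => (hy r hr.1).mono (Set.Ici_subset_Ici.2 hr.1)) (hcont hz)
    (fun r hr => (hz r hr.1).mono (Set.Ici_subset_Ici.2 hr.1)) h₀ ⟨ht, le_rfl⟩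

theorem hasDerivWithinAt_clm_comp {G : Type*} [NormedAddCommGroup G] [NormedSpace ℝ G]
    (A : F →L[ℝ] G) {y : ℝ → F} {y' : F} {s : Set ℝ} {t : ℝ} (hy : HasDerivWithinAt y y' s t) :
    HasDerivWithinAt (fun r => A (y r)) (A y') s t :=
  A.hasFDerivAt.comp_hasDerivWithinAt t hy

theorem expOp_zero_smul (A : F →L[ℝ] F) : expOp ((0 : ℝ) • A) = ContinuousLinearMap.id ℝ F := by
  rw [zero_smul]
  exact NormedSpace.exp_zero

variable [CompleteSpace F]

theorem hasDerivAt_expOp_smul (A : F →L[ℝ] F) (t : ℝ) :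
    HasDerivAt (fun s : ℝ => expOp (s • A)) ((expOp (t • A)).comp A) t :=
  hasDerivAt_exp_smul_const A t

theorem hasDerivAt_expOp_smul_apply (A : F →L[ℝ] F) (x : F) (t : ℝ) :
    HasDerivAt (fun s : ℝ => expOp (s • A) x) (A (expOp (t • A) x)) t :=
  (hasDerivAt_exp_smul_const' A t : HasDerivAt (fun s : ℝ => expOp (s • A)) _ t).clm_apply
    (hasDerivAt_const t x) |>.congr_deriv (by simp; rfl)

theorem hasDerivAt_expOp_sub_smul_apply (A : F →L[ℝ] F) (x : F) (t s : ℝ) :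
    HasDerivAt (fun r : ℝ => expOp ((t - r) • A) x) (-A (expOp ((t - s) • A) x)) s :=
  ((hasDerivAt_expOp_smul_apply A x (t - s)).scomp s ((hasDerivAt_id s).const_sub t)).congr_deriv
    (neg_one_smul ℝ _)

end LinearODE

section Duality

/-- The functional `f ↦ ∫₀¹ g(u) f(u) du` on `C[0,1]`, depending linearly on `g`. -/
def densityFunctional : C(I, ℝ) →L[ℝ] (C(I, ℝ) →L[ℝ] ℝ) :=
  (ContinuousLinearMap.compL ℝ C(I, ℝ) C(I, ℝ) ℝ
    ((ContinuousMap.evalCLM ℝ (0 : I)).comp (integralOp 1))).comp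
      (ContinuousLinearMap.mul ℝ C(I, ℝ))

theorem densityFunctional_apply (g f : C(I, ℝ)) : densityFunctional g f = ∫ u : I, g u * f u := by
  simp [densityFunctional, integralOp_apply]

theorem densityFunctional_mul_left (r g f : C(I, ℝ)) :
    densityFunctional (r * g) f = densityFunctional g (r * f) := by
  simp only [densityFunctional_apply, ContinuousMap.mul_apply]
  exact integral_congr_ae (ae_of_all _ fun u => by ring)

theorem densityFunctional_integralOp_swap (k : C(I × I, ℝ)) (g f : C(I, ℝ)) :
    densityFunctional (integralOp (k.comp .prodSwap) g) f =
      densityFunctional g (integralOp k f) := by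
  simp only [densityFunctional_apply, integralOp_apply, ← integral_mul_const, ← integral_const_mul]
  rw [integral_integral_swap]
  · refine integral_congr_ae (ae_of_all _ fun v => integral_congr_ae (ae_of_all _ fun u => ?_))
    simp only [ContinuousMap.comp_apply, ContinuousMap.prodSwap_apply]
    ring
  · exact (by fun_prop : Continuous _).integrable_of_hasCompactSupport
      (HasCompactSupport.of_compactSpace _)

end Duality

namespace UrnCoefficients

variable (κ : UrnCoefficients)

/-- The kernel `(u, v) ↦ λ(u,v) a₃(u,v) + λ(v,u) a₂(v,u)` of the integral part of `P₁`. -/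
def gainKernel : C(I × I, ℝ) :=
  ⟨fun p => (κ.lam p : ℝ) * (κ.a₃ p : ℝ) + (κ.lam p.swap : ℝ) * (κ.a₂ p.swap : ℝ), by fun_prop⟩

theorem opP₁_eq :
    κ.opP₁ = ContinuousLinearMap.mul ℝ C(I, ℝ) κ.rate + integralOp κ.gainKernel := rfl

theorem densityOp_eq :
    κ.densityOp = ContinuousLinearMap.mul ℝ C(I, ℝ) κ.rate +
      integralOp (κ.gainKernel.comp .prodSwap) := by
  rw [densityOp]
  congr 2
  ext p
  exact add_comm _ _

theorem densityFunctional_densityOp (g : C(I, ℝ)) :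
    densityFunctional (κ.densityOp g) = (densityFunctional g).comp κ.opP₁ := by
  ext f
  simp only [densityOp_eq, opP₁_eq, ContinuousLinearMap.comp_apply, add_apply, map_add,
    ContinuousLinearMap.mul_apply', densityFunctional_mul_left, densityFunctional_integralOp_swap]

/-- The solution `μ_t = μ_0 ∘ exp(t P₁)` of the hydrodynamic equation, in terms of the dual
`exp(t P₁)^*` of the semigroup. -/
def hydrodynamic (φ : C(I, ℝ)) (t : ℝ) : C(I, ℝ) →L[ℝ] ℝ :=
  (densityFunctional φ).comp (expOp (t • κ.opP₁))

/-- The solution `ρ_t` of the equation for the density. -/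
def density (φ : C(I, ℝ)) (t : ℝ) : C(I, ℝ) := expOp (t • κ.densityOp) φ

theorem isHydrodynamicSolution_hydrodynamic (φ : C(I, ℝ)) :
    κ.IsHydrodynamicSolution φ (κ.hydrodynamic φ) where
  deriv t _ := hasDerivWithinAt_clm_comp (G := C(I, ℝ) →L[ℝ] ℝ)
    (ContinuousLinearMap.compL ℝ C(I, ℝ) C(I, ℝ) ℝ (densityFunctional φ))
    (hasDerivAt_expOp_smul κ.opP₁ t).hasDerivWithinAt
  init f := by
    rw [hydrodynamic, expOp_zero_smul, ContinuousLinearMap.comp_id, densityFunctional_apply]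

theorem isDensitySolution_density (φ : C(I, ℝ)) : κ.IsDensitySolution φ (κ.density φ) where
  deriv t _ := (hasDerivAt_expOp_smul_apply κ.densityOp φ t).hasDerivWithinAt
  init := by rw [density, expOp_zero_smul, ContinuousLinearMap.id_apply]

variable {κ}

theorem IsHydrodynamicSolution.eqOn {φ : C(I, ℝ)} {μ μ' : ℝ → (C(I, ℝ) →L[ℝ] ℝ)}
    (hμ' : κ.IsHydrodynamicSolution φ μ') (hμ : κ.IsHydrodynamicSolution φ μ) :
    Set.EqOn μ' μ (Set.Ici 0) :=
  eqOn_of_hasDerivWithinAt_clm ((ContinuousLinearMap.compL ℝ C(I, ℝ) C(I, ℝ) ℝ).flip κ.opP₁)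
    hμ'.deriv hμ.deriv (by ext f; rw [hμ'.init, hμ.init])

theorem IsDensitySolution.eqOn {φ : C(I, ℝ)} {ρ ρ' : ℝ → C(I, ℝ)}
    (hρ' : κ.IsDensitySolution φ ρ') (hρ : κ.IsDensitySolution φ ρ) :
    Set.EqOn ρ' ρ (Set.Ici 0) :=
  eqOn_of_hasDerivWithinAt_clm κ.densityOp hρ'.deriv hρ.deriv (by rw [hρ'.init, hρ.init])

theorem IsDensitySolution.isHydrodynamicSolution {φ : C(I, ℝ)} {ρ : ℝ → C(I, ℝ)}
    (hρ : κ.IsDensitySolution φ ρ) :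
    κ.IsHydrodynamicSolution φ fun t => densityFunctional (ρ t) where
  deriv t ht := by
    rw [← densityFunctional_densityOp]
    exact hasDerivWithinAt_clm_comp (G := C(I, ℝ) →L[ℝ] ℝ) densityFunctional (hρ.deriv t ht)
  init f := by rw [hρ.init, densityFunctional_apply]

theorem hydrodynamic_eq_integral_density (φ f : C(I, ℝ)) {t : ℝ} (ht : 0 ≤ t) :
    κ.hydrodynamic φ t f = ∫ u : I, κ.density φ t u * f u := by
  rw [(κ.isHydrodynamicSolution_hydrodynamic φ).eqOn
    (κ.isDensitySolution_density φ).isHydrodynamicSolution ht, densityFunctional_apply]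

end UrnCoefficients

/-! ### The urn system as a jump process -/

section Energy

variable {N : ℕ}

/-- One plus the mean square of a configuration, the Lyapunov function of the `N`-urn system. -/
def energy (x : Config N) : ℝ := 1 + (1 / (N : ℝ)) * ∑ i, (x i : ℝ) ^ 2

theorem one_le_energy (x : Config N) : 1 ≤ energy x :=
  le_add_of_nonneg_right (by positivity)

theorem energy_nonneg (x : Config N) : 0 ≤ energy x := zero_le_one.trans (one_le_energy x)

theorem continuous_energy : Continuous (energy (N := N)) := by
  unfold energy
  fun_prop

theorem continuous_empirical (g : C(I, ℝ)) : Continuous fun x : Config N => empirical x g := by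
  unfold empirical
  fun_prop

theorem energy_le_two {x : Config N} (hx : ∀ i, x i ≤ 1) : energy x ≤ 2 := by
  have hsum : ∑ i, (x i : ℝ) ^ 2 ≤ N := by
    simpa using Finset.sum_le_sum fun i (_ : i ∈ Finset.univ) =>
      pow_le_one₀ (n := 2) (x i).coe_nonneg (NNReal.coe_le_one.2 (hx i))
  calc energy x ≤ 1 + 1 / (N : ℝ) * N := by
        unfold energy
        gcongr
    _ ≤ 1 + 1 := by
        rw [one_div]
        gcongr
        exact inv_mul_le_one
    _ = 2 := one_add_one_eq_two

theorem coord_isBigO_sqrt_energy (i : Fin N) :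
    (fun x : Config N => (x i : ℝ)) =O[⊤] fun x => √(energy x) := by
  have hN : (0 : ℝ) < N := by exact_mod_cast i.pos
  refine isBigO_top.2 ⟨√N, fun x => ?_⟩
  have hi : (x i : ℝ) ^ 2 ≤ ∑ k, (x k : ℝ) ^ 2 :=
    Finset.single_le_sum (fun k _ => sq_nonneg (x k : ℝ)) (Finset.mem_univ i)
  rw [Real.norm_eq_abs, Real.norm_of_nonneg (Real.sqrt_nonneg _), ← Real.sqrt_mul hN.le]
  refine Real.abs_le_sqrt (hi.trans ?_)
  rw [energy, mul_add, one_div, mul_inv_cancel_left₀ hN.ne']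
  exact le_add_of_nonneg_left (by positivity)

theorem one_isBigO_sqrt_energy :
    (fun _ : Config N => (1 : ℝ)) =O[⊤] fun x => √(energy x) :=
  isBigO_of_le _ fun x => by simpa [abs_of_nonneg] using one_le_energy x

theorem mul_isBigO_energy {h k : Config N → ℝ} (hh : h =O[⊤] fun x => √(energy x))
    (hk : k =O[⊤] fun x => √(energy x)) : (fun x => h x * k x) =O[⊤] energy (N := N) :=
  (hh.mul hk).congr_right fun x => Real.mul_self_sqrt (energy_nonneg x)

theorem abs_empirical_le (x : Config N) (g : C(I, ℝ)) : |empirical x g| ≤ ‖g‖ * empirical x 1 := by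
  simp only [empirical, ContinuousMap.one_apply, mul_one]
  rw [abs_mul, abs_of_nonneg (by positivity), mul_left_comm, Finset.mul_sum]
  gcongr
  refine (Finset.abs_sum_le_sum_abs _ _).trans (Finset.sum_le_sum fun i _ => ?_)
  rw [abs_mul, abs_of_nonneg (x i).coe_nonneg, mul_comm]
  gcongr
  exact g.norm_coe_le_norm _

theorem empirical_one_nonneg (x : Config N) : 0 ≤ empirical x 1 := by
  simp only [empirical, ContinuousMap.one_apply, mul_one]
  positivity

theorem empirical_one_sq_le_energy (x : Config N) : empirical x 1 ^ 2 ≤ energy x := by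
  have hcs : (∑ i, (x i : ℝ)) ^ 2 ≤ N * ∑ i, (x i : ℝ) ^ 2 := by
    simpa using sq_sum_le_card_mul_sum_sq (s := Finset.univ) (f := fun i => (x i : ℝ))
  calc empirical x 1 ^ 2 = (1 / (N : ℝ)) ^ 2 * (∑ i, (x i : ℝ)) ^ 2 := by
        simp [empirical, mul_pow]
    _ ≤ (1 / (N : ℝ)) ^ 2 * (N * ∑ i, (x i : ℝ) ^ 2) := by gcongr
    _ = (1 / (N : ℝ)) * N * ((1 / (N : ℝ)) * ∑ i, (x i : ℝ) ^ 2) := by ring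
    _ ≤ 1 * ((1 / (N : ℝ)) * ∑ i, (x i : ℝ) ^ 2) := by
        rw [one_div]
        gcongr
        exact inv_mul_le_one
    _ ≤ energy x := by
        rw [energy, one_mul]
        exact le_add_of_nonneg_left zero_le_one

theorem empirical_isBigO_sqrt_energy (g : C(I, ℝ)) :
    (fun x : Config N => empirical x g) =O[⊤] fun x => √(energy x) :=
  (IsBigO.fun_sum fun i _ =>
    ((coord_isBigO_sqrt_energy i).const_mul_left (g (site i))).congr_left
      fun _ => mul_comm _ _).const_mul_left _

theorem memLp_empirical {ν : Measure (Config N)} (h : Integrable energy ν) (g : C(I, ℝ)) :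
    MemLp (fun x => empirical x g) 2 ν := by
  have hg := (continuous_empirical (N := N) g).measurable
  rw [memLp_two_iff_integrable_sq hg.aestronglyMeasurable]
  refine IsBigO.integrable (hg.pow_const 2).aestronglyMeasurable ?_ h
  simpa only [sq] using
    mul_isBigO_energy (empirical_isBigO_sqrt_energy g) (empirical_isBigO_sqrt_energy g)

end Energy

namespace UrnCoefficients

section Jumps

variable (κ : UrnCoefficients)

/-- The rates of the jumps of the `N`-urn system. Pairs range over the whole square, those on the
diagonal having the rate zero. -/
def jumpRate (N : ℕ) : Fin N ⊕ (Fin N × Fin N) → ℝ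
  | .inl i => κ.b (site i)
  | .inr p => if p.1 = p.2 then 0 else κ.lam (site p.1, site p.2) / N

/-- The jumps `x ↦ x^{i,+}` and `x ↦ x^{(i,j)}` of the `N`-urn system. -/
def jumpMap (N : ℕ) : Fin N ⊕ (Fin N × Fin N) → C(Config N, Config N)
  | .inl i => κ.selfJump i
  | .inr p => κ.pairJump p.1 p.2

variable {N : ℕ}

theorem jumpRate_nonneg (e : Fin N ⊕ (Fin N × Fin N)) : 0 ≤ κ.jumpRate N e := by
  rcases e with i | p
  · exact (κ.b (site i)).coe_nonneg
  · simp only [jumpRate]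
    split_ifs <;> positivity

theorem generator_eq_jumpGen (f : Config N →ᵇ ℝ) (x : Config N) :
    κ.generator N f x = jumpGen (κ.jumpRate N) (κ.jumpMap N) f x := by
  simp only [generator_apply, jumpGen, Fintype.sum_sum_type, Fintype.sum_prod_type, jumpRate,
    jumpMap, Finset.mul_sum]
  congr 1
  refine Finset.sum_congr rfl fun i _ => ?_
  rw [← Finset.add_sum_erase _ _ (Finset.mem_univ i), if_pos rfl, zero_mul, zero_add]
  refine Finset.sum_congr rfl fun j hj => ?_
  rw [if_neg (Finset.ne_of_mem_erase hj).symm]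
  ring

theorem sum_selfJump_sub (F : Fin N → ℝ≥0 → ℝ) (i : Fin N) (x : Config N) :
    ∑ k, F k (κ.selfJump i x k) - ∑ k, F k (x k) = F i (κ.c (site i) * x i) - F i (x i) := by
  rw [← Finset.sum_sub_distrib, Fintype.sum_eq_single i]
  · simp [selfJump]
  · intro k hk
    simp [selfJump, hk]

theorem sum_pairJump_sub (F : Fin N → ℝ≥0 → ℝ) {i j : Fin N} (hij : i ≠ j) (x : Config N) :
    ∑ k, F k (κ.pairJump i j x k) - ∑ k, F k (x k) =
      (F i (κ.a₁ (site i, site j) * x i + κ.a₂ (site i, site j) * x j) - F i (x i)) +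
      (F j (κ.a₃ (site i, site j) * x i + κ.a₄ (site i, site j) * x j) - F j (x j)) := by
  rw [← Finset.sum_sub_distrib, Fintype.sum_eq_add i j hij]
  · simp [pairJump, hij.symm]
  · rintro k ⟨hi, hj⟩
    simp [pairJump, hi, hj]

theorem coord_jumpMap_isBigO_sqrt_energy (e : Fin N ⊕ (Fin N × Fin N)) (k : Fin N) :
    (fun x => (κ.jumpMap N e x k : ℝ)) =O[⊤] fun x => √(energy x) := by
  rcases e with i | ⟨i, j⟩
  · simp only [jumpMap, selfJump, ContinuousMap.coe_mk]
    split_ifs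
    · exact (coord_isBigO_sqrt_energy i).const_mul_left _
    · exact coord_isBigO_sqrt_energy k
  · simp only [jumpMap, pairJump, ContinuousMap.coe_mk]
    split_ifs
    · exact ((coord_isBigO_sqrt_energy i).const_mul_left _).add
        ((coord_isBigO_sqrt_energy j).const_mul_left _)
    · exact ((coord_isBigO_sqrt_energy i).const_mul_left _).add
        ((coord_isBigO_sqrt_energy j).const_mul_left _)
    · exact coord_isBigO_sqrt_energy k

theorem energy_comp_jumpMap_isBigO (e : Fin N ⊕ (Fin N × Fin N)) :
    (fun x => energy (κ.jumpMap N e x)) =O[⊤] energy (N := N) := by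
  have hone : (fun _ : Config N => (1 : ℝ)) =O[⊤] energy (N := N) := by
    simpa using mul_isBigO_energy one_isBigO_sqrt_energy one_isBigO_sqrt_energy
  refine hone.add (IsBigO.const_mul_left (IsBigO.fun_sum fun k _ => ?_) _)
  simpa only [sq] using mul_isBigO_energy (κ.coord_jumpMap_isBigO_sqrt_energy e k)
    (κ.coord_jumpMap_isBigO_sqrt_energy e k)

end Jumps

section ForwardEquation

variable {κ : UrnCoefficients} {N : ℕ} {Ω : Type*} [MeasurableSpace Ω] {P : Measure Ω}
  [IsFiniteMeasure P] {X : ℝ≥0 → Ω → Config N}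

theorem IsUrnSystem.integral_eq (hX : κ.IsUrnSystem N P X) (f : Config N →ᵇ ℝ) (t : ℝ≥0) :
    ∫ ω, f (X t ω) ∂P = ∫ ω, κ.semigroup N t f (X 0 ω) ∂P := by
  have hm : (⨆ r ∈ Set.Iic (0 : ℝ≥0), MeasurableSpace.comap (X r) inferInstance) ≤
      (inferInstance : MeasurableSpace Ω) :=
    iSup₂_le fun r _ => (hX.measurable r).comap_le
  have h := integral_congr_ae (hX.markov 0 t f)
  rwa [integral_condExp hm, zero_add] at h

theorem IsUrnSystem.isForwardSolution (hX : κ.IsUrnSystem N P X) :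
    IsForwardSolution (κ.jumpRate N) (κ.jumpMap N) fun s => P.map (X s.toNNReal) where
  isFiniteMeasure _ := inferInstance
  hasDeriv f s hs := by
    have hint : ∀ g : Config N →ᵇ ℝ, Integrable g (P.map (X 0)) := fun g => g.integrable _
    let ℓ : (Config N →ᵇ ℝ) →L[ℝ] ℝ := LinearMap.mkContinuous
      { toFun := fun g => ∫ x, g x ∂P.map (X 0)
        map_add' := fun g h => integral_add (hint g) (hint h)
        map_smul' := fun r g => integral_const_mul r _ } ((P.map (X 0)).real Set.univ)
      fun g => by simpa [mul_comm] using
        norm_integral_le_of_norm_le_const (ae_of_all _ fun x => g.norm_coe_le_norm x)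
    have hmap : ∀ (g : Config N →ᵇ ℝ) (t : ℝ≥0), ∫ x, g x ∂P.map (X t) = ∫ ω, g (X t ω) ∂P :=
      fun g t => integral_map (hX.measurable t).aemeasurable
        g.continuous.measurable.aestronglyMeasurable
    have hlaw : ∀ (g : Config N →ᵇ ℝ) (r : ℝ), 0 ≤ r →
        ∫ x, g x ∂P.map (X r.toNNReal) = ℓ (expOp (r • κ.generator N) g) := fun g r hr => by
      rw [hmap, hX.integral_eq, ← hmap, semigroup, Real.coe_toNNReal r hr]
      rfl
    have hderiv : HasDerivAt (fun r : ℝ => ℓ (expOp (r • κ.generator N) f))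
        (ℓ (expOp (s • κ.generator N) (κ.generator N f))) s :=
      ℓ.hasFDerivAt.comp_hasDerivAt s
        ((hasDerivAt_expOp_smul (κ.generator N) s).clm_apply (hasDerivAt_const s f)
          |>.congr_deriv (by simp))
    simp only [← generator_eq_jumpGen]
    rw [hlaw _ s hs]
    exact hderiv.hasDerivWithinAt.congr (hlaw f) (hlaw f s hs)

end ForwardEquation

section Bounds

variable (κ : UrnCoefficients)

/-- `K ≥ 1` is a common upper bound of all coefficients. -/
structure IsBound (K : ℝ) : Prop where
  one_le : 1 ≤ K
  b_le : ∀ u, (κ.b u : ℝ) ≤ K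
  c_le : ∀ u, (κ.c u : ℝ) ≤ K
  lam_le : ∀ p, (κ.lam p : ℝ) ≤ K
  a₁_le : ∀ p, (κ.a₁ p : ℝ) ≤ K
  a₂_le : ∀ p, (κ.a₂ p : ℝ) ≤ K
  a₃_le : ∀ p, (κ.a₃ p : ℝ) ≤ K
  a₄_le : ∀ p, (κ.a₄ p : ℝ) ≤ K

theorem exists_isBound : ∃ K, κ.IsBound K := by
  have hbdd : ∀ {Y : Type} [TopologicalSpace Y] [CompactSpace Y] (f : C(Y, ℝ≥0)),
      ∀ᶠ K : ℝ in atTop, ∀ y, (f y : ℝ) ≤ K := fun f => by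
    obtain ⟨M, hM⟩ := isCompact_univ.exists_bound_of_continuousOn
      (f := fun y => (f y : ℝ)) (by fun_prop)
    filter_upwards [eventually_ge_atTop M] with K hK y
    exact (le_abs_self _).trans ((hM y trivial).trans hK)
  have hall : ∀ᶠ K in atTop, κ.IsBound K := by
    filter_upwards [eventually_ge_atTop 1, hbdd κ.b, hbdd κ.c, hbdd κ.lam, hbdd κ.a₁, hbdd κ.a₂,
      hbdd κ.a₃, hbdd κ.a₄] with K h₁ hb hc hl ha₁ ha₂ ha₃ ha₄
    exact ⟨h₁, hb, hc, hl, ha₁, ha₂, ha₃, ha₄⟩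
  exact hall.exists

variable {κ} {N : ℕ} {K : ℝ}

theorem IsBound.nonneg (hK : κ.IsBound K) : 0 ≤ K := zero_le_one.trans hK.one_le

theorem IsBound.sum_jumpRate_mul_le (hK : κ.IsBound K) {D : Fin N ⊕ (Fin N × Fin N) → ℝ}
    {y : Fin N → ℝ} {R : ℝ} (hy : ∀ i, 0 ≤ y i) (hR : 0 ≤ R) (hself : ∀ i, D (.inl i) ≤ R * y i)
    (hpair : ∀ i j, i ≠ j → D (.inr (i, j)) ≤ R * (y i + y j)) :
    ∑ e, κ.jumpRate N e * D e ≤ 3 * K * R * ∑ i, y i := by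
  have hself' : ∀ i, κ.jumpRate N (.inl i) * D (.inl i) ≤ K * (R * y i) := fun i =>
    (mul_le_mul_of_nonneg_left (hself i) (κ.jumpRate_nonneg _)).trans
      (mul_le_mul_of_nonneg_right (hK.b_le _) (mul_nonneg hR (hy i)))
  have hpair' : ∀ i j, κ.jumpRate N (.inr (i, j)) * D (.inr (i, j)) ≤
      K / N * (R * (y i + y j)) := fun i j => by
    have hRy : 0 ≤ R * (y i + y j) := mul_nonneg hR (add_nonneg (hy i) (hy j))
    have := hK.nonneg
    by_cases hij : i = j
    · simp only [jumpRate, if_pos hij, zero_mul]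
      positivity
    · refine (mul_le_mul_of_nonneg_left (hpair i j hij) (κ.jumpRate_nonneg _)).trans
        (mul_le_mul_of_nonneg_right ?_ hRy)
      simp only [jumpRate, if_neg hij]
      gcongr
      exact hK.lam_le _
  rw [Fintype.sum_sum_type, Fintype.sum_prod_type]
  refine (add_le_add (Finset.sum_le_sum fun i _ => hself' i)
    (Finset.sum_le_sum fun i _ => Finset.sum_le_sum fun j _ => hpair' i j)).trans_eq ?_
  rcases eq_or_ne N 0 with rfl | hN
  · simp
  simp only [← Finset.mul_sum, Finset.sum_add_distrib, Finset.sum_const, Finset.card_univ,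
    Fintype.card_fin, nsmul_eq_mul]
  field_simp
  ring

theorem add_mul_sq_le {M α β : ℝ} (hα : |α| ≤ M) (hβ : |β| ≤ M) (r s : ℝ) :
    (α * r + β * s) ^ 2 ≤ 2 * M ^ 2 * (r ^ 2 + s ^ 2) := by
  have hα₂ : α ^ 2 ≤ M ^ 2 := sq_le_sq' (abs_le.1 hα).1 (abs_le.1 hα).2
  have hβ₂ : β ^ 2 ≤ M ^ 2 := sq_le_sq' (abs_le.1 hβ).1 (abs_le.1 hβ).2
  calc (α * r + β * s) ^ 2 ≤ 2 * (α ^ 2 * r ^ 2 + β ^ 2 * s ^ 2) := by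
        simpa only [mul_pow] using add_sq_le (a := α * r) (b := β * s)
    _ ≤ 2 * (M ^ 2 * r ^ 2 + M ^ 2 * s ^ 2) := by
        linarith [mul_le_mul_of_nonneg_right hα₂ (sq_nonneg r),
          mul_le_mul_of_nonneg_right hβ₂ (sq_nonneg s)]
    _ = 2 * M ^ 2 * (r ^ 2 + s ^ 2) := by ring

theorem IsBound.energy_selfJump_sub_le (hK : κ.IsBound K) (i : Fin N) (x : Config N) :
    energy (κ.selfJump i x) - energy x ≤ 4 * K ^ 2 / N * (x i : ℝ) ^ 2 := by
  have hc : (κ.c (site i) : ℝ) ^ 2 ≤ K ^ 2 := pow_le_pow_left₀ NNReal.zero_le_coe (hK.c_le _) 2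
  have hsum := κ.sum_selfJump_sub (fun _ r => (r : ℝ) ^ 2) i x
  rw [energy, energy, add_sub_add_left_eq_sub, ← mul_sub, hsum, mul_comm_div, one_mul,
    div_mul_eq_mul_div]
  gcongr
  push_cast
  nlinarith [mul_le_mul_of_nonneg_right hc (sq_nonneg (x i : ℝ)), sq_nonneg (K * x i)]

theorem IsBound.energy_pairJump_sub_le (hK : κ.IsBound K) {i j : Fin N} (hij : i ≠ j)
    (x : Config N) :
    energy (κ.pairJump i j x) - energy x ≤ 4 * K ^ 2 / N * ((x i : ℝ) ^ 2 + (x j : ℝ) ^ 2) := by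
  have habs : ∀ {a : ℝ≥0}, (a : ℝ) ≤ K → |(a : ℝ)| ≤ K := fun h => by
    rwa [abs_of_nonneg NNReal.zero_le_coe]
  have hi := add_mul_sq_le (habs (hK.a₁_le (site i, site j))) (habs (hK.a₂_le (site i, site j)))
    (x i) (x j)
  have hj := add_mul_sq_le (habs (hK.a₃_le (site i, site j))) (habs (hK.a₄_le (site i, site j)))
    (x i) (x j)
  have hsum := κ.sum_pairJump_sub (fun _ r => (r : ℝ) ^ 2) hij x
  rw [energy, energy, add_sub_add_left_eq_sub, ← mul_sub, hsum, mul_comm_div, one_mul,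
    div_mul_eq_mul_div]
  gcongr
  push_cast
  linarith [sq_nonneg (x i : ℝ), sq_nonneg (x j : ℝ)]

theorem IsBound.isLyapunov_energy (hK : κ.IsBound K) (N : ℕ) :
    IsLyapunov (κ.jumpRate N) (κ.jumpMap N) energy (12 * K ^ 3) where
  continuous := continuous_energy
  nonneg := energy_nonneg
  rate_nonneg := κ.jumpRate_nonneg
  growth_nonneg := mul_nonneg (by norm_num) (pow_nonneg hK.nonneg 3)
  jumpGen_le x := by
    have := hK.nonneg
    calc jumpGen (κ.jumpRate N) (κ.jumpMap N) energy x
        ≤ 3 * K * (4 * K ^ 2 / N) * ∑ i, (x i : ℝ) ^ 2 :=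
          hK.sum_jumpRate_mul_le (fun i => sq_nonneg _) (by positivity)
            (fun i => hK.energy_selfJump_sub_le i x) fun i j hij => hK.energy_pairJump_sub_le hij x
      _ = 12 * K ^ 3 * (1 / N * ∑ i, (x i : ℝ) ^ 2) := by ring
      _ ≤ 12 * K ^ 3 * energy x := by
          gcongr
          exact le_add_of_nonneg_left zero_le_one
  comp_isBigO := κ.energy_comp_jumpMap_isBigO

end Bounds

section EmpiricalMeasure

variable {κ : UrnCoefficients} {N : ℕ}

theorem empirical_selfJump_sub (g : C(I, ℝ)) (i : Fin N) (x : Config N) :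
    empirical (κ.selfJump i x) g - empirical x g =
      1 / N * (((κ.c (site i) : ℝ) - 1) * g (site i) * x i) := by
  have h := κ.sum_selfJump_sub (fun k r => (r : ℝ) * g (site k)) i x
  rw [empirical, empirical, ← mul_sub, h]
  push_cast
  ring

theorem empirical_pairJump_sub (g : C(I, ℝ)) {i j : Fin N} (hij : i ≠ j) (x : Config N) :
    empirical (κ.pairJump i j x) g - empirical x g =
      1 / N * ((((κ.a₁ (site i, site j) : ℝ) - 1) * g (site i) +
          κ.a₃ (site i, site j) * g (site j)) * x i +
        (κ.a₂ (site i, site j) * g (site i) +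
          ((κ.a₄ (site i, site j) : ℝ) - 1) * g (site j)) * x j) := by
  have h := κ.sum_pairJump_sub (fun k r => (r : ℝ) * g (site k)) hij x
  rw [empirical, empirical, ← mul_sub, h]
  push_cast
  ring

theorem IsBound.carreDuChamp_empirical_le {K : ℝ} (hK : κ.IsBound K) (g : C(I, ℝ))
    (x : Config N) :
    ∑ e, κ.jumpRate N e * (empirical (κ.jumpMap N e x) g - empirical x g) ^ 2 ≤
      24 * K ^ 3 * ‖g‖ ^ 2 / N * energy x := by
  have hK₀ := hK.nonneg
  have hcoe : ∀ {a : ℝ≥0}, (a : ℝ) ≤ K → ∀ u, |(a : ℝ) * g u| ≤ K * ‖g‖ := fun h u => by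
    rw [abs_mul, abs_of_nonneg NNReal.zero_le_coe]
    exact mul_le_mul h (g.norm_coe_le_norm u) (abs_nonneg _) hK₀
  have hsub : ∀ {a : ℝ≥0}, (a : ℝ) ≤ K → ∀ u, |((a : ℝ) - 1) * g u| ≤ K * ‖g‖ := fun {a} h u => by
    rw [abs_mul]
    refine mul_le_mul (abs_le.2 ?_) (g.norm_coe_le_norm u) (abs_nonneg _) hK₀
    constructor <;> linarith [a.coe_nonneg, hK.one_le]
  have hadd : ∀ {α β : ℝ}, |α| ≤ K * ‖g‖ → |β| ≤ K * ‖g‖ → |α + β| ≤ 2 * K * ‖g‖ :=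
    fun hα hβ => (abs_add_le _ _).trans (by linarith)
  have hM : 0 ≤ K * ‖g‖ := mul_nonneg hK₀ (norm_nonneg g)
  calc ∑ e, κ.jumpRate N e * (empirical (κ.jumpMap N e x) g - empirical x g) ^ 2
      ≤ 3 * K * ((1 / N) ^ 2 * (2 * (2 * K * ‖g‖) ^ 2)) * ∑ i, (x i : ℝ) ^ 2 := by
        refine hK.sum_jumpRate_mul_le (fun i => sq_nonneg (x i : ℝ)) (by positivity)
          (fun i => ?_) fun i j hij => ?_
        · rw [jumpMap, empirical_selfJump_sub, mul_pow, mul_assoc ((1 / (N : ℝ)) ^ 2)]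
          gcongr
          simpa only [zero_pow two_ne_zero, zero_mul, add_zero] using
            add_mul_sq_le (β := 0) (hadd (β := 0) (hsub (hK.c_le (site i)) (site i))
              (by simpa)) (by rw [abs_zero]; positivity) (x i) 0
        · rw [jumpMap, empirical_pairJump_sub g hij, mul_pow, mul_assoc]
          gcongr
          exact add_mul_sq_le (hadd (hsub (hK.a₁_le _) _) (hcoe (hK.a₃_le _) _))
            (hadd (hcoe (hK.a₂_le _) _) (hsub (hK.a₄_le _) _)) _ _
    _ = 24 * K ^ 3 * ‖g‖ ^ 2 / N * (1 / N * ∑ i, (x i : ℝ) ^ 2) := by ring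
    _ ≤ 24 * K ^ 3 * ‖g‖ ^ 2 / N * energy x := by
        gcongr
        exact le_add_of_nonneg_left zero_le_one

end EmpiricalMeasure

section Drift

variable (κ : UrnCoefficients)

/-- The effect of the urns at `v` on the urn at `u`, seen by the test function `g`: integrated over
`v` it is the part of `P₁ g u` which is due to the pair jumps. -/
def interaction (g : C(I, ℝ)) : C(I × I, ℝ) :=
  κ.lossKernel * g.comp .fst + κ.gainKernel * g.comp .snd

theorem interaction_apply (g : C(I, ℝ)) (u v : I) :
    κ.interaction g (u, v) = κ.lossKernel (u, v) * g u + κ.gainKernel (u, v) * g v := rfl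

/-- The discretization of `P₁` through which the generator of the `N`-urn system acts on the
empirical measure, see `jumpGen_empirical`. The diagonal is subtracted since an urn does not
interact with itself. -/
def discreteOp (N : ℕ) (g : C(I, ℝ)) : C(I, ℝ) where
  toFun u := (κ.b u : ℝ) * ((κ.c u : ℝ) - 1) * g u +
    siteAverage N (fun v => κ.interaction g (u, v)) - 1 / N * κ.interaction g (u, u)
  continuous_toFun := by
    unfold siteAverage
    fun_prop

theorem discreteOp_apply_site {N : ℕ} (g : C(I, ℝ)) (i : Fin N) :
    κ.discreteOp N g (site i) = (κ.b (site i) : ℝ) * ((κ.c (site i) : ℝ) - 1) * g (site i) +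
      1 / N * ∑ j ∈ Finset.univ.erase i, κ.interaction g (site i, site j) := by
  simp only [discreteOp, ContinuousMap.coe_mk, siteAverage, smul_eq_mul]
  rw [← Finset.add_sum_erase _ _ (Finset.mem_univ i)]
  ring

theorem sum_jumpRate_pair_mul_empirical_sub {N : ℕ} (g : C(I, ℝ)) (x : Config N) :
    ∑ i, ∑ j, κ.jumpRate N (.inr (i, j)) *
        (empirical (κ.jumpMap N (.inr (i, j)) x) g - empirical x g) =
      1 / N * ∑ i, x i * (1 / N * ∑ j ∈ Finset.univ.erase i,
        κ.interaction g (site i, site j)) := by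
  set A : Fin N → Fin N → ℝ := fun i j => ((κ.a₁ (site i, site j) : ℝ) - 1) * g (site i) +
    κ.a₃ (site i, site j) * g (site j)
  set B : Fin N → Fin N → ℝ := fun i j => κ.a₂ (site i, site j) * g (site i) +
    ((κ.a₄ (site i, site j) : ℝ) - 1) * g (site j)
  set w : Fin N → Fin N → ℝ := fun i j => κ.jumpRate N (.inr (i, j))
  have hdiag : ∀ i, w i i = 0 := fun i => if_pos rfl
  have hjump : ∀ i j, w i j * (empirical (κ.jumpMap N (.inr (i, j)) x) g - empirical x g) =
      1 / N * (x i * (w i j * A i j) + x j * (w i j * B i j)) := fun i j => by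
    rcases eq_or_ne i j with rfl | hij
    · simp only [hdiag, zero_mul, mul_zero, add_zero]
    · rw [jumpMap, empirical_pairJump_sub g hij]
      ring
  have hinter : ∀ i j, i ≠ j →
      w i j * A i j + w j i * B j i = 1 / N * κ.interaction g (site i, site j) := fun i j hij => by
    simp only [w, A, B, jumpRate, if_neg hij, if_neg hij.symm, interaction_apply, lossKernel,
      gainKernel, ContinuousMap.coe_mk, Prod.swap_prod_mk]
    ring
  have hrow : ∀ i, ∑ j, (w i j * A i j + w j i * B j i) =
      1 / N * ∑ j ∈ Finset.univ.erase i, κ.interaction g (site i, site j) := fun i => by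
    rw [← Finset.add_sum_erase _ _ (Finset.mem_univ i), hdiag, zero_mul, zero_mul, add_zero,
      zero_add, Finset.mul_sum]
    exact Finset.sum_congr rfl fun j hj => hinter i j (Finset.ne_of_mem_erase hj).symm
  calc _ = 1 / N * ∑ i, ∑ j, (x i * (w i j * A i j) + x j * (w i j * B i j)) := by
        simp only [Finset.mul_sum]
        exact Finset.sum_congr rfl fun i _ => Finset.sum_congr rfl fun j _ => hjump i j
    _ = 1 / N * ∑ i, ∑ j, (x i * (w i j * A i j) + x i * (w j i * B j i)) := by
        simp only [Finset.sum_add_distrib]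
        rw [Finset.sum_comm (f := fun i j => x j * (w i j * B i j))]
    _ = _ := by simp only [← mul_add, ← Finset.mul_sum, hrow]

theorem jumpGen_empirical {N : ℕ} (g : C(I, ℝ)) (x : Config N) :
    jumpGen (κ.jumpRate N) (κ.jumpMap N) (fun y => empirical y g) x =
      empirical x (κ.discreteOp N g) := by
  rw [jumpGen, Fintype.sum_sum_type, Fintype.sum_prod_type, sum_jumpRate_pair_mul_empirical_sub]
  simp only [jumpRate, jumpMap, empirical_selfJump_sub]
  simp only [empirical, discreteOp_apply_site, mul_add, Finset.sum_add_distrib]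
  congr 1
  rw [Finset.mul_sum]
  exact Finset.sum_congr rfl fun i _ => by ring

theorem opP₁_apply_eq_integral_interaction (g : C(I, ℝ)) (u : I) :
    κ.opP₁ g u = (κ.b u : ℝ) * ((κ.c u : ℝ) - 1) * g u + ∫ v : I, κ.interaction g (u, v) := by
  have hint : ∀ {h : I → ℝ}, Continuous h → Integrable h := fun hc =>
    hc.integrable_of_hasCompactSupport (HasCompactSupport.of_compactSpace _)
  simp only [interaction_apply]
  rw [integral_add (hint (by fun_prop)) (hint (by fun_prop)), integral_mul_const]
  simp only [opP₁_eq, rate, add_apply, ContinuousMap.add_apply, ContinuousLinearMap.mul_apply',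
    ContinuousMap.mul_apply, integralOp_apply, ContinuousMap.coe_mk, ContinuousMap.one_apply,
    mul_one]
  ring

theorem discreteOp_sub_opP₁_apply (N : ℕ) (g : C(I, ℝ)) (u : I) :
    (κ.discreteOp N g - κ.opP₁ g) u =
      (siteAverage N (fun v => κ.interaction g (u, v)) - ∫ v : I, κ.interaction g (u, v)) -
        1 / N * κ.interaction g (u, u) := by
  rw [ContinuousMap.sub_apply, opP₁_apply_eq_integral_interaction, discreteOp,
    ContinuousMap.coe_mk]
  ring

theorem exists_tendsto_zero_norm_discreteOp_sub_opP₁_le {Y : Type*} [TopologicalSpace Y]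
    [CompactSpace Y] (g : C(Y, C(I, ℝ))) :
    ∃ η : ℕ → ℝ, Tendsto η atTop (𝓝 0) ∧ ∀ N y, ‖κ.discreteOp N (g y) - κ.opP₁ (g y)‖ ≤ η N := by
  let G : C(I, C(Y × I, ℝ)) := ContinuousMap.curry
    ⟨fun p => κ.lossKernel (p.2.2, p.1) * g.uncurry (p.2.1, p.2.2) +
      κ.gainKernel (p.2.2, p.1) * g.uncurry (p.2.1, p.1), by fun_prop⟩
  have hG : ∀ y u v, κ.interaction (g y) (u, v) = G v (y, u) := fun _ _ _ => rfl
  refine ⟨fun N => ‖siteAverage N G - ∫ v, G v‖ + 1 / N * ‖G‖, ?_, fun N y => ?_⟩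
  · simpa using (tendsto_iff_norm_sub_tendsto_zero.1 (tendsto_siteAverage G)).add
      ((tendsto_one_div_atTop_nhds_zero_nat (𝕜 := ℝ)).mul_const ‖G‖)
  · refine (ContinuousMap.norm_le _ (by positivity)).2 fun u => ?_
    rw [discreteOp_sub_opP₁_apply]
    simp only [hG]
    refine (norm_sub_le _ _).trans
      (add_le_add (abs_siteAverage_sub_integral_le G (y, u) N) ?_)
    rw [norm_mul, Real.norm_of_nonneg (by positivity)]
    gcongr
    exact ((G u).norm_coe_le_norm (y, u)).trans (G.norm_coe_le_norm u)

end Drift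

end UrnCoefficients

/-! ### The second moment along the backward equation -/

theorem empirical_add {N : ℕ} (x : Config N) (g h : C(I, ℝ)) :
    empirical x (g + h) = empirical x g + empirical x h := by
  simp only [empirical, ContinuousMap.add_apply, mul_add, Finset.sum_add_distrib]

theorem empirical_one_le_energy {N : ℕ} (x : Config N) : empirical x 1 ≤ energy x := by
  linarith [sq_nonneg (empirical x 1 - 1), one_le_energy x, empirical_one_sq_le_energy x]

namespace UrnCoefficients

section BackwardEquation

variable {κ : UrnCoefficients} {N : ℕ} {K : ℝ}

theorem jumpGen_empirical_sub_const (g : C(I, ℝ)) (a : ℝ) (x : Config N) :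
    jumpGen (κ.jumpRate N) (κ.jumpMap N) (fun y => empirical y g - a) x =
      empirical x (κ.discreteOp N g) := by
  rw [← jumpGen_empirical]
  simp only [jumpGen, sub_sub_sub_cancel_right]

theorem mul_empirical_le_energy {g h : C(I, ℝ)} {B η : ℝ} (hg : ‖g‖ ≤ B) (hh : ‖h‖ ≤ η) (a : ℝ)
    (x : Config N) :
    (empirical x g - a) * empirical x h ≤ (B + |a|) * η * energy x := by
  have hm := empirical_one_nonneg x
  have hB : 0 ≤ B := (norm_nonneg g).trans hg
  have hη : 0 ≤ η := (norm_nonneg h).trans hh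
  have hga : |empirical x g - a| ≤ B * empirical x 1 + |a| :=
    (abs_sub _ _).trans (add_le_add_left ((abs_empirical_le x g).trans (by gcongr)) _)
  calc (empirical x g - a) * empirical x h ≤ |empirical x g - a| * |empirical x h| :=
        (le_abs_self _).trans_eq (abs_mul _ _)
    _ ≤ (B * empirical x 1 + |a|) * (η * empirical x 1) := by
        gcongr
        exact (abs_empirical_le x h).trans (by gcongr)
    _ = B * η * empirical x 1 ^ 2 + |a| * η * empirical x 1 := by ring
    _ ≤ B * η * energy x + |a| * η * energy x := by
        gcongr
        exacts [empirical_one_sq_le_energy x, empirical_one_le_energy x]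
    _ = (B + |a|) * η * energy x := by ring

theorem IsBound.drift_sq_empirical_sub_le (hK : κ.IsBound K) {g g' : C(I, ℝ)} {B η : ℝ}
    (hB : ‖g‖ ≤ B) (hη : ‖g' + κ.discreteOp N g‖ ≤ η) (a : ℝ) (x : Config N) :
    2 * (empirical x g - a) * empirical x g' +
        jumpGen (κ.jumpRate N) (κ.jumpMap N) (fun y => (empirical y g - a) ^ 2) x ≤
      (24 * K ^ 3 * B ^ 2 / N + 2 * ((B + |a|) * η)) * energy x := by
  have hcarre : ∑ e, κ.jumpRate N e * (empirical (κ.jumpMap N e x) g - empirical x g) ^ 2 ≤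
      24 * K ^ 3 * B ^ 2 / N * energy x := by
    have := hK.nonneg
    have := energy_nonneg x
    exact (hK.carreDuChamp_empirical_le g x).trans (by gcongr)
  rw [jumpGen_sq, jumpGen_empirical_sub_const]
  simp only [sub_sub_sub_cancel_right]
  calc _ = 2 * ((empirical x g - a) * empirical x (g' + κ.discreteOp N g)) +
        ∑ e, κ.jumpRate N e * (empirical (κ.jumpMap N e x) g - empirical x g) ^ 2 := by
        rw [empirical_add]
        ring
    _ ≤ 2 * ((B + |a|) * η * energy x) + 24 * K ^ 3 * B ^ 2 / N * energy x := by
        exact add_le_add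
          (mul_le_mul_of_nonneg_left (mul_empirical_le_energy hB hη a x) zero_le_two) hcarre
    _ = _ := by ring

theorem IsBound.integral_sq_empirical_sub_le (hK : κ.IsBound K) {ν : ℝ → Measure (Config N)}
    (hν : IsForwardSolution (κ.jumpRate N) (κ.jumpMap N) ν) (h₀ : Integrable energy (ν 0))
    {g g' : ℝ → C(I, ℝ)} {t : ℝ} (ht : 0 ≤ t) (hg : ∀ s ∈ Set.Icc 0 t, HasDerivAt g (g' s) s)
    {B η : ℝ} (hB : ∀ s ∈ Set.Icc 0 t, ‖g s‖ ≤ B)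
    (hη : ∀ s ∈ Set.Icc 0 t, ‖g' s + κ.discreteOp N (g s)‖ ≤ η) (a : ℝ) :
    ∫ x, (empirical x (g t) - a) ^ 2 ∂ν t ≤ ∫ x, (empirical x (g 0) - a) ^ 2 ∂ν 0 +
      (24 * K ^ 3 * B ^ 2 / N + 2 * ((B + |a|) * η)) *
        (Real.exp (12 * K ^ 3 * t) * ∫ x, energy x ∂ν 0) * t := by
  -- `empirical x (g s) - a` is a combination of the coordinates and the constant `1`.
  let h : Option (Fin N) → Config N → ℝ := fun k x => k.elim 1 fun i => x i
  let c : ℝ → C(I, ℝ) → Option (Fin N) → ℝ := fun b f k => k.elim b fun i => 1 / N * f (site i)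
  have hsum : ∀ (b : ℝ) (f : C(I, ℝ)) (x : Config N),
      ∑ k, c b f k * h k x = empirical x f + b := fun b f x => by
    simp only [c, h, Fintype.sum_option, Option.elim, empirical, Finset.mul_sum, mul_one]
    rw [add_comm]
    exact congrArg (· + b) (Finset.sum_congr rfl fun i _ => by ring)
  have hc : ∀ k, Continuous (h k) := by
    rintro (_ | i) <;> simp only [h, Option.elim] <;> fun_prop
  have hO : ∀ k, h k =O[⊤] fun x => √(energy x) := by
    rintro (_ | i)
    exacts [one_isBigO_sqrt_energy, coord_isBigO_sqrt_energy i]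
  have hcd : ∀ k, ∀ s ∈ Set.Icc 0 t,
      HasDerivWithinAt (fun s => c (-a) (g s) k) (c 0 (g' s) k) (Set.Ici 0) s := by
    rintro (_ | i) s hs
    · exact hasDerivWithinAt_const s _ (-a)
    · exact (hasDerivWithinAt_clm_comp (ContinuousMap.evalCLM ℝ (site i))
        (hg s hs).hasDerivWithinAt).const_mul _
  have hK₀ := hK.nonneg
  have hB₀ : 0 ≤ B := (norm_nonneg _).trans (hB 0 ⟨le_rfl, ht⟩)
  have hη₀ : 0 ≤ η := (norm_nonneg _).trans (hη 0 ⟨le_rfl, ht⟩)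
  have hle := hν.integral_sum_sq_le (hK.isLyapunov_energy N) h₀ hc
    (fun k l => mul_isBigO_energy (hO k) (hO l)) (c := fun k s => c (-a) (g s) k)
    (c' := fun k s => c 0 (g' s) k) ht
    (δ := 24 * K ^ 3 * B ^ 2 / N + 2 * ((B + |a|) * η)) (by positivity) hcd fun s hs x => by
      simpa only [hsum, add_zero, ← sub_eq_add_neg] using
        hK.drift_sq_empirical_sub_le (hB s hs) (hη s hs) a x
  simpa only [hsum, ← sub_eq_add_neg] using hle

end BackwardEquation

end UrnCoefficients

/-- Random initial configurations, with the laws `ν N`, have the density `φ` in the limit: their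
second moments are bounded, and their empirical measures converge weakly to `φ(u) du`, in `L²`. -/
structure HasInitialDensity (φ : C(I, ℝ)) (ν : ∀ N, Measure (Config N)) : Prop where
  integrable_energy : ∀ N, Integrable energy (ν N)
  bounded_energy : ∃ M : ℝ, ∀ N, ∫ x, energy x ∂ν N ≤ M
  tendsto : ∀ g : C(I, ℝ),
    Tendsto (fun N => ∫ x, (empirical x g - ∫ u : I, φ u * g u) ^ 2 ∂ν N) atTop (𝓝 0)

theorem tendsto_eLpNorm_two_zero {ι : Type*} {l : Filter ι} {Ω : ι → Type*}
    [∀ k, MeasurableSpace (Ω k)] {P : ∀ k, Measure (Ω k)} {Y : ∀ k, Ω k → ℝ}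
    (hY : ∀ k, MemLp (Y k) 2 (P k)) (h : Tendsto (fun k => ∫ ω, Y k ω ^ 2 ∂P k) l (𝓝 0)) :
    Tendsto (fun k => eLpNorm (Y k) 2 (P k)) l (𝓝 0) := by
  have heq : ∀ k, eLpNorm (Y k) 2 (P k) = ENNReal.ofReal √(∫ ω, Y k ω ^ 2 ∂P k) := fun k => by
    rw [(hY k).eLpNorm_eq_integral_rpow_norm two_ne_zero ENNReal.ofNat_ne_top, Real.sqrt_eq_rpow]
    simp
  simpa [heq] using ENNReal.tendsto_ofReal h.sqrt

namespace UrnCoefficients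

section HydrodynamicLimit

variable {κ : UrnCoefficients} {φ : C(I, ℝ)}

theorem tendsto_integral_sq_empirical_sub {ν : ∀ N, ℝ → Measure (Config N)}
    (hν : ∀ N, IsForwardSolution (κ.jumpRate N) (κ.jumpMap N) (ν N))
    (h₀ : HasInitialDensity φ fun N => ν N 0) {t : ℝ} (ht : 0 ≤ t) (f : C(I, ℝ)) :
    Tendsto (fun N => ∫ x, (empirical x f - κ.hydrodynamic φ t f) ^ 2 ∂ν N t) atTop (𝓝 0) := by
  obtain ⟨K, hK⟩ := κ.exists_isBound
  obtain ⟨M, hM⟩ := h₀.bounded_energy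
  let g : ℝ → C(I, ℝ) := fun s => expOp ((t - s) • κ.opP₁) f
  have hderiv : ∀ s, HasDerivAt g (-κ.opP₁ (g s)) s :=
    hasDerivAt_expOp_sub_smul_apply κ.opP₁ f t
  have hcont : Continuous g := continuous_iff_continuousAt.2 fun s => (hderiv s).continuousAt
  have hgt : g t = f := by simp only [g, sub_self, expOp_zero_smul, ContinuousLinearMap.id_apply]
  have hg₀ : κ.hydrodynamic φ t f = ∫ u : I, φ u * g 0 u := by
    simp only [g, sub_zero, hydrodynamic, ContinuousLinearMap.comp_apply, densityFunctional_apply]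
  obtain ⟨B, hB⟩ := isCompact_Icc.exists_bound_of_continuousOn
    (hcont.continuousOn (s := Set.Icc 0 t))
  obtain ⟨η, hη, hηle⟩ := κ.exists_tendsto_zero_norm_discreteOp_sub_opP₁_le
    ⟨fun s : Set.Icc 0 t => g s, hcont.comp continuous_subtype_val⟩
  set a := κ.hydrodynamic φ t f
  have hle : ∀ N, ∫ x, (empirical x f - a) ^ 2 ∂ν N t ≤ ∫ x, (empirical x (g 0) - a) ^ 2 ∂ν N 0 +
      (24 * K ^ 3 * B ^ 2 / N + 2 * ((B + |a|) * η N)) * (Real.exp (12 * K ^ 3 * t) * M) * t := by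
    intro N
    have hK₀ := hK.nonneg
    have hB₀ : 0 ≤ B := (norm_nonneg _).trans (hB 0 ⟨le_rfl, ht⟩)
    have hη₀ : 0 ≤ η N := (norm_nonneg _).trans (hηle N ⟨0, le_rfl, ht⟩)
    have hdefect : ∀ s ∈ Set.Icc 0 t, ‖-κ.opP₁ (g s) + κ.discreteOp N (g s)‖ ≤ η N := fun s hs => by
      rw [neg_add_eq_sub]
      exact hηle N ⟨s, hs⟩
    have h := hK.integral_sq_empirical_sub_le (hν N) (h₀.integrable_energy N) ht
      (fun s _ => hderiv s) hB hdefect a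
    rw [hgt] at h
    refine h.trans ?_
    gcongr
    exact hM N
  refine squeeze_zero (fun N => integral_nonneg fun x => sq_nonneg _) hle ?_
  have hN := tendsto_const_div_atTop_nhds_zero_nat (24 * K ^ 3 * B ^ 2)
  simpa [← hg₀] using (h₀.tendsto (g 0)).add
    (((hN.add ((hη.const_mul (B + |a|)).const_mul 2)).mul_const
      (Real.exp (12 * K ^ 3 * t) * M)).mul_const t)

end HydrodynamicLimit

end UrnCoefficients

/-! ### Bernoulli initial configurations -/

theorem integral_sq_sub_eq_variance_add {Ω : Type*} [MeasurableSpace Ω] {P : Measure Ω}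
    [IsProbabilityMeasure P] {Y : Ω → ℝ} (hY : MemLp Y 2 P) (a : ℝ) :
    ∫ ω, (Y ω - a) ^ 2 ∂P = Var[Y; P] + (∫ ω, Y ω ∂P - a) ^ 2 := by
  have hvar := variance_eq_sub (hY.sub (memLp_const a))
  have hmean : ∫ ω, (Y ω - a) ∂P = ∫ ω, Y ω ∂P - a := by
    rw [integral_sub (hY.integrable one_le_two) (integrable_const a), integral_const,
      probReal_univ, one_smul]
  simp only [Pi.pow_apply, Pi.sub_apply, hmean] at hvar
  rw [← variance_sub_const hY.aestronglyMeasurable a]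
  exact sub_eq_iff_eq_add.1 hvar.symm

namespace BernoulliInitial

section OneConfiguration

variable {Ω : Type*} [MeasurableSpace Ω] {φ : C(I, ℝ)} {N : ℕ} {P : Measure Ω}
  [IsProbabilityMeasure P] {X₀ : Ω → Config N}

theorem ae_eq_zero_or_eq_one (h : BernoulliInitial φ P X₀) (hm : Measurable X₀) (i : Fin N) :
    ∀ᵐ ω ∂P, X₀ ω i = 0 ∨ X₀ ω i = 1 := by
  have hmi : Measurable fun ω => X₀ ω i := (measurable_pi_apply i).comp hm
  have h₀ : MeasurableSet {ω | X₀ ω i = 0} := hmi (measurableSet_singleton 0)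
  have h₁ : MeasurableSet {ω | X₀ ω i = 1} := hmi (measurableSet_singleton 1)
  have hdisj : Disjoint {ω | X₀ ω i = 0} {ω | X₀ ω i = 1} :=
    Set.disjoint_left.2 fun _ hω hω' => zero_ne_one (hω.symm.trans hω')
  have hunion : P.real ({ω | X₀ ω i = 0} ∪ {ω | X₀ ω i = 1}) = 1 := by
    rw [measureReal_union hdisj h₁, h.prob_zero, h.prob_one, sub_add_cancel]
  rw [measureReal_def, ENNReal.toReal_eq_one_iff] at hunion
  exact (prob_compl_eq_zero_iff (h₀.union h₁)).2 hunion

theorem ae_le_one (h : BernoulliInitial φ P X₀) (hm : Measurable X₀) :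
    ∀ᵐ ω ∂P, ∀ i, X₀ ω i ≤ 1 := by
  filter_upwards [ae_all_iff.2 (h.ae_eq_zero_or_eq_one hm)] with ω hω i
  rcases hω i with hi | hi <;> simp [hi]

theorem memLp_coord (h : BernoulliInitial φ P X₀) (hm : Measurable X₀) (i : Fin N) :
    MemLp (fun ω => (X₀ ω i : ℝ)) 2 P := by
  refine MemLp.of_bound (by fun_prop) 1 ?_
  filter_upwards [h.ae_le_one hm] with ω hω
  simpa using hω i

theorem integral_coord (h : BernoulliInitial φ P X₀) (hm : Measurable X₀) (i : Fin N) :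
    ∫ ω, (X₀ ω i : ℝ) ∂P = φ (site i) := by
  have h₁ : MeasurableSet {ω | X₀ ω i = 1} :=
    ((measurable_pi_apply i).comp hm) (measurableSet_singleton 1)
  have hindicator : (fun ω => (X₀ ω i : ℝ)) =ᵐ[P] {ω | X₀ ω i = 1}.indicator 1 := by
    filter_upwards [h.ae_eq_zero_or_eq_one hm i] with ω hω
    rcases hω with hω | hω <;> simp [hω]
  rw [integral_congr_ae hindicator, integral_indicator_one h₁, h.prob_one]

theorem variance_coord_le_one (h : BernoulliInitial φ P X₀) (hm : Measurable X₀) (i : Fin N) :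
    Var[fun ω => (X₀ ω i : ℝ); P] ≤ 1 := by
  have hIcc : ∀ᵐ ω ∂P, (X₀ ω i : ℝ) ∈ Set.Icc (0 : ℝ) 1 :=
    (h.ae_le_one hm).mono fun ω hω => ⟨(X₀ ω i).coe_nonneg, NNReal.coe_le_one.2 (hω i)⟩
  have := variance_le_sq_of_bounded hIcc (by fun_prop)
  linarith

theorem memLp_empirical (h : BernoulliInitial φ P X₀) (hm : Measurable X₀) (g : C(I, ℝ)) :
    MemLp (fun ω => empirical (X₀ ω) g) 2 P :=
  (memLp_finsetSum _ fun i _ => (h.memLp_coord hm i).mul_const _).const_mul _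

theorem integral_empirical (h : BernoulliInitial φ P X₀) (hm : Measurable X₀) (g : C(I, ℝ)) :
    ∫ ω, empirical (X₀ ω) g ∂P = siteAverage N (φ * g) := by
  unfold empirical
  rw [integral_const_mul, integral_finsetSum _ fun i _ =>
    ((h.memLp_coord hm i).integrable one_le_two).mul_const _]
  simp only [integral_mul_const, h.integral_coord hm, siteAverage, smul_eq_mul,
    ContinuousMap.mul_apply]

theorem variance_empirical_le (h : BernoulliInitial φ P X₀) (hm : Measurable X₀) (g : C(I, ℝ)) :
    Var[fun ω => empirical (X₀ ω) g; P] ≤ ‖g‖ ^ 2 / N := by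
  let Y : Fin N → Ω → ℝ := fun i ω => g (site i) * X₀ ω i
  have hsum : (fun ω => empirical (X₀ ω) g) = fun ω => 1 / (N : ℝ) * (∑ i, Y i) ω := by
    ext ω
    simp only [empirical, Y, Finset.sum_apply, mul_comm]
  have hindep : ∀ i j, i ≠ j → IndepFun (Y i) (Y j) P := fun i j hij =>
    (h.indep.indepFun hij).comp (φ := fun r : ℝ≥0 => g (site i) * (r : ℝ))
      (ψ := fun r : ℝ≥0 => g (site j) * (r : ℝ)) (by fun_prop) (by fun_prop)
  have hvar : ∀ i, Var[Y i; P] ≤ ‖g‖ ^ 2 := fun i => by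
    calc Var[Y i; P] = g (site i) ^ 2 * Var[fun ω => (X₀ ω i : ℝ); P] := variance_const_mul ..
      _ ≤ ‖g‖ ^ 2 * 1 := by
          exact mul_le_mul (sq_le_sq' (neg_le_of_abs_le (g.norm_coe_le_norm _))
            (le_of_abs_le (g.norm_coe_le_norm _))) (h.variance_coord_le_one hm i)
            (variance_nonneg _ _) (sq_nonneg _)
      _ = ‖g‖ ^ 2 := mul_one _
  rw [hsum, variance_const_mul, IndepFun.variance_sum
    (fun i _ => (h.memLp_coord hm i).const_mul _) fun i _ j _ hij => hindep i j hij]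
  calc (1 / (N : ℝ)) ^ 2 * ∑ i, Var[Y i; P] ≤ (1 / (N : ℝ)) ^ 2 * ∑ _i : Fin N, ‖g‖ ^ 2 := by
        gcongr with i
        exact hvar i
    _ = ‖g‖ ^ 2 / N := by
        rw [Finset.sum_const, Finset.card_univ, Fintype.card_fin, nsmul_eq_mul]
        rcases eq_or_ne (N : ℝ) 0 with hN | hN
        · simp [hN]
        · field_simp

theorem integral_sq_empirical_sub_le (h : BernoulliInitial φ P X₀) (hm : Measurable X₀)
    (g : C(I, ℝ)) (a : ℝ) :
    ∫ ω, (empirical (X₀ ω) g - a) ^ 2 ∂P ≤ ‖g‖ ^ 2 / N + (siteAverage N (φ * g) - a) ^ 2 := by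
  rw [integral_sq_sub_eq_variance_add (h.memLp_empirical hm g), h.integral_empirical hm]
  gcongr
  exact h.variance_empirical_le hm g

end OneConfiguration

theorem hasInitialDensity {φ : C(I, ℝ)} {Ω : ℕ → Type*} [∀ N, MeasurableSpace (Ω N)]
    {P : ∀ N, Measure (Ω N)} [∀ N, IsProbabilityMeasure (P N)] {X₀ : ∀ N, Ω N → Config N}
    (h : ∀ N, BernoulliInitial φ (P N) (X₀ N)) (hm : ∀ N, Measurable (X₀ N)) :
    HasInitialDensity φ fun N => (P N).map (X₀ N) := by
  have hle : ∀ N, ∀ᵐ ω ∂P N, energy (X₀ N ω) ≤ 2 := fun N =>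
    ((h N).ae_le_one (hm N)).mono fun _ => energy_le_two
  have hme : ∀ N, Measurable (energy (N := N)) := fun N => continuous_energy.measurable
  have hint : ∀ N, Integrable (fun ω => energy (X₀ N ω)) (P N) := fun N =>
    .of_bound ((hme N).comp (hm N)).aestronglyMeasurable 2 <| (hle N).mono fun ω hω => by
      rwa [Real.norm_eq_abs, abs_of_nonneg (energy_nonneg _)]
  refine ⟨fun N => ?_, ⟨2, fun N => ?_⟩, fun g => ?_⟩
  · exact (integrable_map_measure (hme N).aestronglyMeasurable (hm N).aemeasurable).2 (hint N)
  · rw [integral_map (hm N).aemeasurable (hme N).aestronglyMeasurable]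
    simpa using integral_mono_ae (hint N) (integrable_const 2) (hle N)
  · have hg : ∀ N, Continuous fun x : Config N => (empirical x g - ∫ u : I, φ u * g u) ^ 2 :=
      fun N => ((continuous_empirical g).sub continuous_const).pow 2
    simp only [integral_map (hm _).aemeasurable (hg _).measurable.aestronglyMeasurable]
    refine squeeze_zero (fun N => integral_nonneg fun ω => sq_nonneg _)
      (fun N => (h N).integral_sq_empirical_sub_le (hm N) g _) ?_
    simpa using (tendsto_const_div_atTop_nhds_zero_nat (‖g‖ ^ 2)).add
      (((tendsto_siteAverage (φ * g)).sub_const (∫ u : I, φ u * g u)).pow 2)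

end BernoulliInitial

/-! ### The hydrodynamic limit -/

theorem UrnCoefficients.IsUrnSystem.memLp_empirical {κ : UrnCoefficients} {Ω : Type*}
    [MeasurableSpace Ω] {N : ℕ} {P : Measure Ω} [IsFiniteMeasure P] {X : ℝ≥0 → Ω → Config N}
    (hX : κ.IsUrnSystem N P X) (h₀ : Integrable energy (P.map (X 0))) (t : ℝ≥0) (f : C(I, ℝ)) :
    MemLp (fun ω => empirical (X t ω) f) 2 P := by
  obtain ⟨K, hK⟩ := κ.exists_isBound
  have h := hX.isForwardSolution.integrable_lyapunov (hK.isLyapunov_energy N)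
    (by rwa [Real.toNNReal_zero]) t.coe_nonneg
  rw [Real.toNNReal_coe] at h
  exact (_root_.memLp_empirical h f).comp_measurePreserving
    ((hX.measurable t).measurePreserving P)

theorem theorem2p2_general (κ : UrnCoefficients) (φ : C(I, ℝ))
    {Ω : ℕ → Type*} [∀ N, MeasurableSpace (Ω N)] (P : ∀ N, Measure (Ω N))
    [∀ N, IsFiniteMeasure (P N)] (X : ∀ N, ℝ≥0 → Ω N → Config N)
    (hX : ∀ N, κ.IsUrnSystem N (P N) (X N))
    (h₀ : HasInitialDensity φ fun N => (P N).map (X N 0)) :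
    ∃ (μ : ℝ → (C(I, ℝ) →L[ℝ] ℝ)) (ρ : ℝ → C(I, ℝ)),
      (κ.IsHydrodynamicSolution φ μ ∧
        ∀ μ', κ.IsHydrodynamicSolution φ μ' → Set.EqOn μ' μ (Set.Ici 0)) ∧
      (κ.IsDensitySolution φ ρ ∧
        ∀ ρ', κ.IsDensitySolution φ ρ' → Set.EqOn ρ' ρ (Set.Ici 0)) ∧
      ∀ (t : ℝ≥0) (f : C(I, ℝ)),
        μ t f = ∫ u : I, ρ t u * f u ∧
        (∀ N, MemLp (fun ω => empirical (X N t ω) f) 2 (P N)) ∧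
        Tendsto (fun N => eLpNorm (fun ω => empirical (X N t ω) f - μ t f) 2 (P N))
          atTop (𝓝 0) := by
  have hμ := κ.isHydrodynamicSolution_hydrodynamic φ
  have hρ := κ.isDensitySolution_density φ
  refine ⟨κ.hydrodynamic φ, κ.density φ, ⟨hμ, fun μ' h => h.eqOn hμ⟩,
    ⟨hρ, fun ρ' h => h.eqOn hρ⟩, fun t f =>
    ⟨κ.hydrodynamic_eq_integral_density φ f t.coe_nonneg, ?_⟩⟩
  have hL : ∀ N, MemLp (fun ω => empirical (X N t ω) f) 2 (P N) := fun N =>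
    (hX N).memLp_empirical (h₀.integrable_energy N) t f
  refine ⟨hL, tendsto_eLpNorm_two_zero (fun N => (hL N).sub (memLp_const _)) ?_⟩
  have hlaw := UrnCoefficients.tendsto_integral_sq_empirical_sub
    (fun N => (hX N).isForwardSolution) (by simpa only [Real.toNNReal_zero] using h₀)
    t.coe_nonneg f
  have hcont : ∀ N, Continuous fun x : Config N =>
      (empirical x f - κ.hydrodynamic φ t f) ^ 2 := fun N =>
    ((continuous_empirical f).sub continuous_const).pow 2
  simpa only [Real.toNNReal_coe, integral_map ((hX _).measurable t).aemeasurable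
    (hcont _).measurable.aestronglyMeasurable] using hlaw

end

theorem theorem2p2 (κ : UrnCoefficients) (φ : C(I, ℝ))
    {Ω : ℕ → Type*} [∀ N, MeasurableSpace (Ω N)] (P : ∀ N, Measure (Ω N))
    [∀ N, IsProbabilityMeasure (P N)] (X : ∀ N, ℝ≥0 → Ω N → Config N)
    (hX : ∀ N, κ.IsUrnSystem N (P N) (X N))
    (hA : ∀ N, BernoulliInitial φ (P N) (X N 0)) :
    ∃ (μ : ℝ → (C(I, ℝ) →L[ℝ] ℝ)) (ρ : ℝ → C(I, ℝ)),
      (κ.IsHydrodynamicSolution φ μ ∧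
        ∀ μ', κ.IsHydrodynamicSolution φ μ' → Set.EqOn μ' μ (Set.Ici 0)) ∧
      (κ.IsDensitySolution φ ρ ∧
        ∀ ρ', κ.IsDensitySolution φ ρ' → Set.EqOn ρ' ρ (Set.Ici 0)) ∧
      ∀ (t : ℝ≥0) (f : C(I, ℝ)),
        μ t f = ∫ u : I, ρ t u * f u ∧
        (∀ N, MemLp (fun ω => empirical (X N t ω) f) 2 (P N)) ∧
        Tendsto (fun N => eLpNorm (fun ω => empirical (X N t ω) f - μ t f) 2 (P N))
          atTop (𝓝 0) :=
  theorem2p2_general κ φ P X hX <|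
    BernoulliInitial.hasInitialDensity hA fun N => (hX N).measurable 0
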